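/- Let $\mathbb{Z}_0=\mathbb{Z}\setminus\{0\}$, and for $s\in\mathbb{R}$ let $\dot H^s$ be the space of complex sequences $a=(a_k)_{k\in\mathbb{Z}_0}$ with $\|a\|_{\dot H^s}^2=\sum_{k\in\mathbb{Z}_0}|k|^{2s}|a_k|^2<\infty$ (Fourier coefficients of functions on the circle with mean value zero); $a$ is called real if $a_{-k}=\overline{a_k}$ for all $k$. Consider the periodic Korteweg--de Vries equation in Fourier form $$\partial_t v_k=\tfrac12 ik\sum_{k_1+k_2=k}e^{3ikk_1k_2t}v_{k_1}v_{k_2},\qquad v_k(0)=v^0_k,\qquad k\in\mathbb{Z}_0,\qquad(1)$$ with $k_1,k_2\in\mathbb{Z}_0$. A function $v$ is a solution of (1) on $[0,T]$ if $v\in L_\infty([0,T];\dot H^0)$ and, for every $k\in\mathbb{Z}_0$ and every $t\in[0,T]$, $$v_k(t)-v_k(0)=\tfrac12 ik\int_0^t\sum_{k_1+k_2=k}e^{3ikk_1k_2t'}v_{k_1}(t')v_{k_2}(t')\,dt'.$$ For $m\in\mathbb{N}$ let $(\Pi_ma)_k=a_k$ if $|k|\le m$ and $(\Pi_ma)_k=0$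 if $|k|>m$. The Galerkin system is $$\partial_tv^{(m)}_k=\tfrac12ik\,\Pi_m\sum_{k_1+k_2=k}e^{3ikk_1k_2t}(\Pi_mv^{(m)})_{k_1}(\Pi_mv^{(m)})_{k_2},\qquad v^{(m)}_k(0)=v^0_k,\qquad k\in\mathbb{Z}_0.\qquad(2)$$ Theorem. Let $s_0>0$, $T>0$ and $M_0,N\ge0$. There is a constant $M_{s_0}$, depending only on $s_0$, $T$, $M_0$ and $N$, such that for every real $v^0\in\dot H^{s_0}$ with $\|v^0\|_{\dot H^0}\le M_0$ and $\|v^0\|_{\dot H^{s_0}}\le N$ the following holds. For every $m\in\mathbb{N}$ system (2) has a solution $v^{(m)}$ on $[0,T]$, and the solutions satisfy, uniformly in $m$, $\|v^{(m)}(t)\|_{\dot H^{s_0}}\le M_{s_0}$ for all $t\in[0,T]$. Moreover, for every $\sigma$ with $0<\sigma<s_0$ there are a subsequence of $(v^{(m)})$ and a function $v^\infty$ on $[0,T]$ with values in the real sequences such that, along the subsequence, $v^{(m)}\to v^\infty$ strongly in $L_p([0,T];\dot H^\sigma)$ for every $1<p<\infty$ and $*$-weakly in $L_\infty([0,T];\dot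 H^{s_0})$ (as the dual of $L_1([0,T];\dot H^{-s_0})$). The function $v^\infty$ is a solution of (1) on $[0,T]$ with $v^\infty(0)=v^0$, it satisfies $$\|v^\infty\|_{L_\infty([0,T];\dot H^{s_0})}\le M_{s_0},$$ and $\|v^\infty(t)\|_{\dot H^0}=\|v^0\|_{\dot H^0}$ for almost every $t\in[0,T]$. -/

import Mathlib

open MeasureTheory Filter Topology
open scoped ENNReal NNReal ComplexConjugate

noncomputable section

namespace PeriodicKdV

/-- The nonzero integers, indexing the Fourier modes of functions of mean value zero. -/
abbrev Z0 : Type := {k : ℤ // k ≠ 0}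

/-- The mode `-k`. -/
def neg (k : Z0) : Z0 := ⟨-k.1, neg_ne_zero.mpr k.2⟩

/-- The Fourier coefficients are those of a real-valued function: `a_{-k} = conj a_k`. -/
def IsRealSeq (a : Z0 → ℂ) : Prop := ∀ k : Z0, a (neg k) = conj (a k)

/-- The norm of the homogeneous Sobolev space of order `s`:
`(∑_{k ≠ 0} |k|^{2s} |a_k|^2)^{1/2}`, with value `∞` exactly when `a` is not in the space. -/
def hNorm (s : ℝ) (a : Z0 → ℂ) : ℝ≥0∞ :=
  (∑' k : Z0, ENNReal.ofReal (|(k.1 : ℝ)| ^ (2 * s) * ‖a k‖ ^ 2)) ^ (1 / 2 : ℝ)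

/-- Lebesgue measure on `[0,T]`. -/
def timeMeasure (T : ℝ) : Measure ℝ := volume.restrict (Set.Icc 0 T)

/-- The norm of `L_p([0,T]; Ḣ^s)`, for `1 ≤ p ≤ ∞`. -/
def bochnerNorm (p : ℝ≥0∞) (s T : ℝ) (v : ℝ → Z0 → ℂ) : ℝ≥0∞ :=
  eLpNorm (fun t => hNorm s (v t)) p (timeMeasure T)

/-- Membership in `L_p([0,T]; Ḣ^s)`. As `Ḣ^s` is a separable Hilbert space in which the
coordinate functionals are total, strong measurability of `v` is the same as measurability
of each coefficient. -/
def MemBochner (p : ℝ≥0∞) (s T : ℝ) (v : ℝ → Z0 → ℂ) : Prop :=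
  (∀ k : Z0, AEStronglyMeasurable (fun t => v t k) (timeMeasure T)) ∧ bochnerNorm p s T v < ∞

/-- Strong (norm) convergence `u n → v` in `L_p([0,T]; Ḣ^s)`. -/
def StrongConv (p : ℝ≥0∞) (s T : ℝ) (u : ℕ → ℝ → Z0 → ℂ) (v : ℝ → Z0 → ℂ) : Prop :=
  (∀ n, MemBochner p s T (u n)) ∧ MemBochner p s T v ∧
    Tendsto (fun n => bochnerNorm p s T (fun t k => u n t k - v t k)) atTop (𝓝 0)

/-- The duality pairing of `Ḣ^s` with `Ḣ^{-s}`. -/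
def pairing (a φ : Z0 → ℂ) : ℂ := ∑' k : Z0, a k * conj (φ k)

/-- Weak-* convergence `u n → v` in `L_∞([0,T]; Ḣ^s)`, the dual of `L_1([0,T]; Ḣ^{-s})`. -/
def WeakStarConv (s T : ℝ) (u : ℕ → ℝ → Z0 → ℂ) (v : ℝ → Z0 → ℂ) : Prop :=
  (∀ n, MemBochner ∞ s T (u n)) ∧ MemBochner ∞ s T v ∧
    ∀ φ : ℝ → Z0 → ℂ, MemBochner 1 (-s) T φ →
      Tendsto (fun n => ∫ t, pairing (u n t) (φ t) ∂(timeMeasure T)) atTop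
        (𝓝 (∫ t, pairing (v t) (φ t) ∂(timeMeasure T)))

/-- The oscillating convolution `∑_{k₁+k₂=k} e^{3 i k k₁ k₂ t} a_{k₁} b_{k₂}`
over pairs of nonzero integers. -/
def oscConv (t : ℝ) (a b : Z0 → ℂ) (k : Z0) : ℂ :=
  ∑' p : {p : Z0 × Z0 // p.1.1 + p.2.1 = k.1},
    Complex.exp (Complex.I * 3 * (k.1 : ℂ) * (p.1.1.1 : ℂ) * (p.1.2.1 : ℂ) * (t : ℂ)) *
      a p.1.1 * b p.1.2

/-- The truncation `Π_m` onto the modes with `|k| ≤ m`. -/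
def trunc (m : ℕ) (a : Z0 → ℂ) : Z0 → ℂ := fun k => if |k.1| ≤ (m : ℤ) then a k else 0

/-- `v` solves on `[0,T]` the Galerkin system
`∂_t v_k = (1/2) i k Π_m ∑_{k₁+k₂=k} e^{3 i k k₁ k₂ t} (Π_m v)_{k₁} (Π_m v)_{k₂}`,
`v_k(0) = v0_k`, `k ≠ 0` (one-sided derivatives at the end points). -/
def IsGalerkinSolution (m : ℕ) (T : ℝ) (v0 : Z0 → ℂ) (v : ℝ → Z0 → ℂ) : Prop :=
  v 0 = v0 ∧ ∀ k : Z0, ∀ t ∈ Set.Icc (0 : ℝ) T,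
    HasDerivWithinAt (fun τ => v τ k)
      (1 / 2 * Complex.I * (k.1 : ℂ) *
        trunc m (oscConv t (trunc m (v t)) (trunc m (v t))) k)
      (Set.Icc 0 T) t

/-- `v` is a solution over `[0,T]` of
`∂_t v_k = (1/2) i k ∑_{k₁+k₂=k} e^{3 i k k₁ k₂ t} v_{k₁} v_{k₂}`, `k ≠ 0`:
it lies in `L_∞([0,T]; Ḣ^0)` and satisfies the time-integrated equation for every `k` and every
`t ∈ [0,T]`. (Then the series converges absolutely for almost every time and is bounded and
measurable in time.) -/
def IsSolution (T : ℝ) (v : ℝ → Z0 → ℂ) : Prop :=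
  MemBochner ∞ 0 T v ∧ ∀ k : Z0, ∀ t ∈ Set.Icc (0 : ℝ) T,
    v t k - v 0 k =
      1 / 2 * Complex.I * (k.1 : ℂ) * ∫ τ in (0 : ℝ)..t, oscConv τ (v τ) (v τ) k

end PeriodicKdV

end

/-!
The Galerkin system consists of finitely many ordinary differential equations and, for real data,
conserves `∑ |v_k|²`; hence it is globally solvable and everything reduces to a bound in `Ḣ^s`,
`s = s₀`, that is uniform in the truncation `m`.

That bound is an energy estimate with one differentiation by parts in time. For a real solution the
derivative of `E = ∑ |k|^{2s} |v_k|²` is, after symmetrization, a sum over triples `a + b + c = 0`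
of `e^{-3iabct} v_a v_b v_c` with the symbol `Ω = a|a|^{2s} + b|b|^{2s} + c|c|^{2s}`. As `abc ≠ 0`,
the oscillating factor is a time derivative divided by `-3iabc`, so `E` minus a cubic correction
with coefficients `Ω / (9abc)` has a quartic derivative (`hasDerivWithinAt_modifiedEnergy`). The
mean value theorem gives `|Ω| ≲ |b| |a|^{2s}` for `|b| ≤ |a|` (`abs_symbol_le`). With this, the
quartic term is at most `C E`, `C` depending only on the conserved `ℓ²` norm (`exists_quartic_le`):
two of the factors combine into a convolution bounded by Cauchy–Schwarz, and what is left is the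
kernel `1_{|b| ≤ |a|} / |a|`, bounded on `ℓ²` by a Hardy inequality (`hardy_modes`). The cubic
correction is of lower order and at most `E / 2 + K` (`exists_cubic_le`). Gronwall's inequality
yields the uniform bound (`exists_modeEnergy_le`). No separate treatment of resonances is needed.

Each coefficient `v_k` is Lipschitz in time, uniformly in `m`, since its derivative is controlled by
`|k|` and the conserved norm. A diagonal subsequence therefore converges coefficientwise at every
time (`exists_subseq_tendsto`). Together with the uniform `Ḣ^s` bound this gives convergence in
`Ḣ^σ`, `σ < s`, at every time (`tendsto_hSum_sub`), and dominated convergence in time gives the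
strong and weak-* convergence, the limit equation, and conservation of the `ℓ²` norm.
-/

namespace PeriodicKdV

/-! ### The symbol of the cubic term -/

theorem one_sub_rpow_le {p r : ℝ} (hr0 : 0 ≤ r) (hr1 : r ≤ 1) :
    1 - r ^ p ≤ max 1 p * (1 - r) := by
  rcases le_total p 1 with h | h
  · rw [max_eq_left h, one_mul]
    have : r ^ (1 : ℝ) ≤ r ^ p := Real.rpow_le_rpow_of_exponent_ge_of_imp hr0 hr1 h (by
      intro _ h0; exact absurd h0 one_ne_zero)
    rw [Real.rpow_one] at this
    linarith
  · rw [max_eq_right h]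
    have := one_add_mul_self_le_rpow_one_add (s := r - 1) (by linarith) h
    rw [add_sub_cancel] at this
    linarith

/-- The mean value bound for `x ↦ x ^ p`, in a form valid for every real `p`. -/
theorem mul_rpow_sub_rpow_le {p x y : ℝ} (hy : 0 ≤ y) (hyx : y ≤ x) :
    x * (x ^ p - y ^ p) ≤ max 1 p * x ^ p * (x - y) := by
  rcases (hy.trans hyx).eq_or_lt with h | h
  · have : y = 0 := by linarith
    simp [← h, this]
  · have h1 := one_sub_rpow_le (p := p) (div_nonneg hy h.le) ((div_le_one h).2 hyx)
    rw [Real.div_rpow hy h.le] at h1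
    have hxp : 0 < x ^ p := Real.rpow_pos_of_pos h p
    have h2 := mul_le_mul_of_nonneg_left h1 (mul_pos h hxp).le
    have e1 : x * x ^ p * (1 - y ^ p / x ^ p) = x * (x ^ p - y ^ p) := by field_simp
    have e2 : x * x ^ p * (max 1 p * (1 - y / x)) = max 1 p * x ^ p * (x - y) := by field_simp
    rwa [e1, e2] at h2

/-- Cancellation in the symbol of the cubic energy term: when `x + y + z = 0` and `|y| ≤ |x|`, the
sum `x|x|^p + y|y|^p + z|z|^p` gains a factor `|y|` over its largest summand `|x|^{p+1}`. -/
theorem abs_symbol_le {p x y z : ℝ} (hp : 0 < p) (h : x + y + z = 0) (hyx : |y| ≤ |x|) :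
    |x * |x| ^ p + y * |y| ^ p + z * |z| ^ p| ≤ (max 1 p + 1) * 2 ^ p * |y| * |x| ^ p := by
  have hz : z = -(x + y) := by linarith
  have hzx : |z| ≤ 2 * |x| := by
    rw [hz, abs_neg]; exact (abs_add_le x y).trans (by linarith)
  have hx2 : |x| ≤ 2 * |x| := by linarith [abs_nonneg x]
  have hP : (2 * |x|) ^ p = 2 ^ p * |x| ^ p := Real.mul_rpow (by norm_num) (abs_nonneg x)
  have hmono : ∀ u : ℝ, |u| ≤ 2 * |x| → |u| ^ p ≤ 2 ^ p * |x| ^ p := fun u hu =>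
    hP ▸ Real.rpow_le_rpow (abs_nonneg u) hu hp.le
  have hdz : abs (|x| - |z|) ≤ |y| := by
    have := abs_abs_sub_abs_le x (-z)
    rw [abs_neg] at this
    refine this.trans (le_of_eq ?_)
    rw [hz]; rw [← abs_neg y]; congr 1; ring
  have h1 : |x| * |(|x| ^ p - |z| ^ p)| ≤ max 1 p * (2 ^ p * |x| ^ p) * |y| := by
    have hm : (0 : ℝ) ≤ max 1 p := le_trans zero_le_one (le_max_left _ _)
    rcases le_total (|z|) (|x|) with hle | hle
    · rw [abs_of_nonneg (sub_nonneg.2 (Real.rpow_le_rpow (abs_nonneg z) hle hp.le))]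
      refine (mul_rpow_sub_rpow_le (p := p) (abs_nonneg z) hle).trans ?_
      have := (le_abs_self _).trans hdz
      have h3 := hmono x hx2
      gcongr
    · rw [abs_sub_comm,
        abs_of_nonneg (sub_nonneg.2 (Real.rpow_le_rpow (abs_nonneg x) hle hp.le))]
      have h2 := mul_rpow_sub_rpow_le (p := p) (abs_nonneg x) hle
      have := (neg_le_abs _).trans hdz
      have h3 := hmono z hzx
      have h4 : 0 ≤ |z| ^ p - |x| ^ p := sub_nonneg.2 (Real.rpow_le_rpow (abs_nonneg x) hle hp.le)
      calc |x| * (|z| ^ p - |x| ^ p) ≤ |z| * (|z| ^ p - |x| ^ p) := by gcongr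
        _ ≤ _ := h2
        _ ≤ _ := by gcongr; linarith
  have h2 : |y| * |(|y| ^ p - |z| ^ p)| ≤ |y| * (2 ^ p * |x| ^ p) := by
    gcongr
    have ha := hmono y (hyx.trans hx2)
    have hb := hmono z hzx
    rw [abs_le]
    constructor <;> linarith [Real.rpow_nonneg (abs_nonneg y) p, Real.rpow_nonneg (abs_nonneg z) p]
  have e : x * |x| ^ p + y * |y| ^ p + z * |z| ^ p
      = x * (|x| ^ p - |z| ^ p) + y * (|y| ^ p - |z| ^ p) := by rw [hz]; ring
  rw [e]
  refine (abs_add_le _ _).trans ?_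
  rw [abs_mul, abs_mul]
  calc _ ≤ _ := add_le_add h1 h2
    _ = _ := by ring

/-- The symmetric form of `abs_symbol_le`, with `z` the smallest of the three frequencies. -/
theorem abs_symbol_le_of_min {s x y z : ℝ} (hs : 0 < s) (h : x + y + z = 0) (hzx : |z| ≤ |x|)
    (hzy : |z| ≤ |y|) :
    |x * |x| ^ (2 * s) + y * |y| ^ (2 * s) + z * |z| ^ (2 * s)| ≤
      (max 1 (2 * s) + 1) * 2 ^ (2 * s) * 2 ^ s * |z| * (|x| ^ s * |y| ^ s) := by
  have h1 := abs_symbol_le (p := 2 * s) (x := x) (y := z) (z := y) (by positivity)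
    (by linarith) hzx
  have hxy : |x| ≤ 2 * |y| := by
    have : x = -(y + z) := by linarith
    rw [this, abs_neg]; exact (abs_add_le y z).trans (by linarith)
  have h2 : |x| ^ (2 * s) ≤ 2 ^ s * (|x| ^ s * |y| ^ s) := by
    rw [two_mul s, Real.rpow_add_of_nonneg (abs_nonneg x) hs.le hs.le]
    have := Real.rpow_le_rpow (abs_nonneg x) hxy hs.le
    rw [Real.mul_rpow (by norm_num) (abs_nonneg y)] at this
    calc |x| ^ s * |x| ^ s ≤ |x| ^ s * (2 ^ s * |y| ^ s) := by gcongr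
      _ = _ := by ring
  calc _ = |x * |x| ^ (2 * s) + z * |z| ^ (2 * s) + y * |y| ^ (2 * s)| := by congr 1; ring
    _ ≤ _ := h1
    _ ≤ (max 1 (2 * s) + 1) * 2 ^ (2 * s) * |z| * (2 ^ s * (|x| ^ s * |y| ^ s)) := by gcongr
    _ = _ := by ring

/-! ### Finite sums over nonzero frequencies and a Hardy inequality -/

/-- The nonzero frequencies of modulus at most `m`. -/
noncomputable def modes (m : ℕ) : Finset ℤ := (Finset.Icc (-(m : ℤ)) m).erase 0

theorem mem_modes {m : ℕ} {k : ℤ} : k ∈ modes m ↔ k ≠ 0 ∧ |k| ≤ m := by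
  simp [modes, abs_le]

theorem neg_mem_modes {m : ℕ} {k : ℤ} : -k ∈ modes m ↔ k ∈ modes m := by
  simp [mem_modes]

theorem sum_modes_neg {M : Type*} [AddCommMonoid M] (m : ℕ) (f : ℤ → M) :
    ∑ k ∈ modes m, f (-k) = ∑ k ∈ modes m, f k :=
  Finset.sum_nbij' (fun k => -k) (fun k => -k) (fun _ h => neg_mem_modes.2 h)
    (fun _ h => neg_mem_modes.2 h) (by simp) (by simp) (by simp)

theorem one_le_abs_of_mem_modes {m : ℕ} {k : ℤ} (hk : k ∈ modes m) : (1 : ℝ) ≤ |(k : ℝ)| := by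
  rw [← Int.cast_abs]
  exact_mod_cast Int.one_le_abs (mem_modes.1 hk).1

theorem sum_modes_abs (m : ℕ) (f : ℝ → ℝ) :
    ∑ k ∈ modes m, f |(k : ℝ)| = 2 * ∑ j ∈ Finset.Icc 1 m, f j := by
  induction m with
  | zero => rw [show modes 0 = ∅ from by decide]; simp
  | succ m ih =>
    have h : modes (m + 1) = insert ((m : ℤ) + 1) (insert (-((m : ℤ) + 1)) (modes m)) := by
      ext k; simp only [Finset.mem_insert, mem_modes, abs_le]; push_cast; omega
    have ha : |((m : ℝ) + 1)| = m + 1 := abs_of_pos (by positivity)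
    have hb : |(-((m : ℝ) + 1))| = m + 1 := by rw [abs_neg, ha]
    rw [h, Finset.sum_insert, Finset.sum_insert, ih, Finset.sum_Icc_succ_top (by omega)]
    · push_cast
      rw [ha, hb]; ring
    · simp only [mem_modes, abs_le]; omega
    · simp only [Finset.mem_insert, mem_modes, abs_le]; omega

theorem sum_Icc_filter_rpow_neg_half_le (m : ℕ) (x : ℝ) :
    ∑ j ∈ Finset.Icc 1 m, (if (j : ℝ) ≤ x then (j : ℝ) ^ (-(1 / 2) : ℝ) else 0) ≤ 2 * √x := by
  suffices h : ∑ j ∈ Finset.Icc 1 m, (if (j : ℝ) ≤ x then (j : ℝ) ^ (-(1 / 2) : ℝ) else 0)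
      ≤ 2 * √(min (m : ℝ) x) from
    h.trans (by gcongr; exact min_le_right _ _)
  induction m with
  | zero => simp
  | succ m ih =>
    rw [Finset.sum_Icc_succ_top (by omega)]
    split_ifs with h
    · push_cast at h ⊢
      rw [min_eq_left (by linarith)] at ih
      rw [min_eq_left h, Real.rpow_neg (by positivity), ← Real.sqrt_eq_rpow]
      have h1 : √((m : ℝ) + 1) ^ 2 = m + 1 := Real.sq_sqrt (by positivity)
      have h2 : √(m : ℝ) ^ 2 = m := Real.sq_sqrt (by positivity)
      have h3 : 0 < √((m : ℝ) + 1) := by positivity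
      have h4 : 0 ≤ √(m : ℝ) := by positivity
      have : (√((m : ℝ) + 1))⁻¹ ≤ 2 * √((m : ℝ) + 1) - 2 * √(m : ℝ) := by
        rw [inv_le_iff_one_le_mul₀ h3]
        nlinarith [sq_nonneg (√((m : ℝ) + 1) - √(m : ℝ))]
      linarith
    · refine le_trans (by simpa using ih) ?_
      gcongr; simp

theorem sum_Icc_filter_rpow_neg_three_half_le (m : ℕ) (x : ℝ) (hx : 1 ≤ x) :
    ∑ j ∈ Finset.Icc 1 m, (if x ≤ (j : ℝ) then (j : ℝ) ^ (-(3 / 2) : ℝ) else 0) ≤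
      3 * (√x)⁻¹ := by
  -- the partial sums up to `m ≥ x` are at most `3 / √x - 2 / √m`
  suffices h : ∑ j ∈ Finset.Icc 1 m, (if x ≤ (j : ℝ) then (j : ℝ) ^ (-(3 / 2) : ℝ) else 0) ≤
      if x ≤ m then 3 * (√x)⁻¹ - 2 * (√m)⁻¹ else 0 by
    refine h.trans ?_
    split_ifs
    · linarith [inv_nonneg.2 (Real.sqrt_nonneg (m : ℝ))]
    · positivity
  induction m with
  | zero => simp [show ¬ x ≤ 0 by linarith]
  | succ m ih =>
    rw [Finset.sum_Icc_succ_top (by omega)]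
    by_cases h : x ≤ ((m + 1 : ℕ) : ℝ)
    · rw [if_pos h, if_pos h]
      push_cast at h ⊢
      have hs : 0 < √((m : ℝ) + 1) := by positivity
      have hs2 : √((m : ℝ) + 1) ^ 2 = m + 1 := Real.sq_sqrt (by positivity)
      have e : ((m : ℝ) + 1) ^ (-(3 / 2) : ℝ) = (√((m : ℝ) + 1))⁻¹ ^ 3 := by
        rw [Real.sqrt_eq_rpow, ← Real.rpow_neg (by positivity), ← Real.rpow_natCast,
          ← Real.rpow_mul (by positivity)]
        norm_num
      rw [e]
      by_cases h' : x ≤ m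
      · rw [if_pos h'] at ih
        have hm : 0 < √(m : ℝ) := Real.sqrt_pos.2 (by linarith)
        have hm2 : √(m : ℝ) ^ 2 = m := Real.sq_sqrt (by positivity)
        have key : (√((m : ℝ) + 1))⁻¹ ^ 3 ≤ 2 * (√(m : ℝ))⁻¹ - 2 * (√((m : ℝ) + 1))⁻¹ := by
          have hle : √(m : ℝ) ≤ √((m : ℝ) + 1) := Real.sqrt_le_sqrt (by linarith)
          generalize √((m : ℝ) + 1) = b at *
          generalize √(m : ℝ) = a at *
          have hab : 1 ≤ 2 * b * (b - a) := by nlinarith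
          have : 2 * a⁻¹ - 2 * b⁻¹ - b⁻¹ ^ 3 = (2 * b ^ 2 * (b - a) - a) / (a * b ^ 3) := by
            field_simp
          rw [← sub_nonneg, this]
          apply div_nonneg _ (by positivity)
          nlinarith
        linarith
      · rw [if_neg h'] at ih
        have h1 : (√((m : ℝ) + 1))⁻¹ ≤ (√x)⁻¹ := by gcongr
        have h2 : (√((m : ℝ) + 1))⁻¹ ^ 3 ≤ (√((m : ℝ) + 1))⁻¹ := by
          have : (√((m : ℝ) + 1))⁻¹ ≤ 1 :=
            inv_le_one_of_one_le₀ (Real.one_le_sqrt.2 (by linarith [Nat.cast_nonneg (α := ℝ) m]))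
          calc (√((m : ℝ) + 1))⁻¹ ^ 3 ≤ (√((m : ℝ) + 1))⁻¹ ^ 1 :=
                pow_le_pow_of_le_one (by positivity) this (by norm_num)
            _ = _ := pow_one _
        linarith
    · have h' : ¬ x ≤ (m : ℝ) := fun hh => h (hh.trans (by push_cast; linarith))
      rw [if_neg h, if_neg h]
      rw [if_neg h'] at ih
      simpa using ih

/-- A Hardy-type inequality: the kernel `1_{|b| ≤ |a|} / |a|` is bounded on `ℓ²`, by Schur's test
with the weights `|a|^{-1/2}`. -/
theorem hardy_modes (m : ℕ) (f h : ℤ → ℝ) :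
    ∑ a ∈ modes m, ∑ b ∈ modes m,
      (if |(b : ℝ)| ≤ |(a : ℝ)| then |(a : ℝ)|⁻¹ * (f a * h b) else 0) ≤
      2 * ∑ a ∈ modes m, f a ^ 2 + 3 * ∑ b ∈ modes m, h b ^ 2 := by
  have key : ∀ a ∈ modes m, ∀ b ∈ modes m,
      (if |(b : ℝ)| ≤ |(a : ℝ)| then |(a : ℝ)|⁻¹ * (f a * h b) else 0) ≤
      1 / 2 * (f a ^ 2 * (√|(a : ℝ)|)⁻¹) *
        (if |(b : ℝ)| ≤ |(a : ℝ)| then |(b : ℝ)| ^ (-(1 / 2) : ℝ) else 0) +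
      1 / 2 * (h b ^ 2 * √|(b : ℝ)|) *
        (if |(b : ℝ)| ≤ |(a : ℝ)| then |(a : ℝ)| ^ (-(3 / 2) : ℝ) else 0) := by
    intro a ha b hb
    have ha1 := one_le_abs_of_mem_modes ha
    have hb1 := one_le_abs_of_mem_modes hb
    split_ifs with hab
    · generalize |(a : ℝ)| = α at *
      generalize |(b : ℝ)| = β at *
      have e1 : β ^ (-(1 / 2) : ℝ) = (√β)⁻¹ := by
        rw [Real.rpow_neg (by linarith), ← Real.sqrt_eq_rpow]
      have e2 : α ^ (-(3 / 2) : ℝ) = (√α)⁻¹ ^ 3 := by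
        rw [Real.sqrt_eq_rpow, ← Real.rpow_neg (by linarith), ← Real.rpow_natCast,
          ← Real.rpow_mul (by linarith)]
        norm_num
      have e3 : α⁻¹ = (√α)⁻¹ ^ 2 := by rw [inv_pow, Real.sq_sqrt (by linarith)]
      rw [e1, e2, e3]
      have hα : 0 < √α := Real.sqrt_pos.2 (by linarith)
      have hβ : 0 < √β := Real.sqrt_pos.2 (by linarith)
      generalize √α = x at *
      generalize √β = y at *
      have : 1 / 2 * (f a ^ 2 * x⁻¹) * y⁻¹ + 1 / 2 * (h b ^ 2 * y) * x⁻¹ ^ 3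
          - x⁻¹ ^ 2 * (f a * h b) = 1 / 2 * x⁻¹ * y⁻¹ * (f a - h b * y * x⁻¹) ^ 2 := by
        field_simp; ring
      have h2 : 0 ≤ 1 / 2 * x⁻¹ * y⁻¹ * (f a - h b * y * x⁻¹) ^ 2 := by positivity
      linarith
    · simp
  refine (Finset.sum_le_sum fun a ha => Finset.sum_le_sum fun b hb => key a ha b hb).trans ?_
  simp_rw [Finset.sum_add_distrib]
  refine add_le_add ?_ ?_
  · rw [Finset.mul_sum]
    refine Finset.sum_le_sum fun a ha => ?_
    have ha1 := one_le_abs_of_mem_modes ha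
    have hpos : 0 < √|(a : ℝ)| := Real.sqrt_pos.2 (by linarith)
    rw [← Finset.mul_sum, sum_modes_abs m
      (fun x => if x ≤ |(a : ℝ)| then x ^ (-(1 / 2) : ℝ) else 0)]
    have := sum_Icc_filter_rpow_neg_half_le m |(a : ℝ)|
    calc _ ≤ 1 / 2 * (f a ^ 2 * (√|(a : ℝ)|)⁻¹) * (2 * (2 * √|(a : ℝ)|)) := by gcongr
      _ = _ := by field_simp
  · rw [Finset.sum_comm, Finset.mul_sum]
    refine Finset.sum_le_sum fun b hb => ?_
    have hb1 := one_le_abs_of_mem_modes hb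
    have hpos : 0 < √|(b : ℝ)| := Real.sqrt_pos.2 (by linarith)
    rw [← Finset.mul_sum, sum_modes_abs m
      (fun x => if |(b : ℝ)| ≤ x then x ^ (-(3 / 2) : ℝ) else 0)]
    have := sum_Icc_filter_rpow_neg_three_half_le m |(b : ℝ)| hb1
    calc _ ≤ 1 / 2 * (h b ^ 2 * √|(b : ℝ)|) * (2 * (3 * (√|(b : ℝ)|)⁻¹)) := by gcongr
      _ = _ := by field_simp

theorem sum_modes_rpow_neg_three_half_le (m : ℕ) :
    ∑ k ∈ modes m, |(k : ℝ)| ^ (-(3 / 2) : ℝ) ≤ 6 := by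
  rw [sum_modes_abs m (fun x => x ^ (-(3 / 2) : ℝ))]
  have := sum_Icc_filter_rpow_neg_three_half_le m 1 le_rfl
  rw [Finset.sum_congr rfl fun j hj => if_pos (by exact_mod_cast (Finset.mem_Icc.1 hj).1)] at this
  simp only [Real.sqrt_one, inv_one, mul_one] at this
  linarith

/-! ### Sums over triples of frequencies with zero sum -/

section Sums

variable {M : Type*} [AddCommMonoid M]

/-- The sum of `F a b c` over triples of nonzero frequencies of modulus at most `m` with
`a + b + c = 0`. -/
noncomputable def triSum (m : ℕ) (F : ℤ → ℤ → ℤ → M) : M :=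
  ∑ a ∈ modes m, ∑ b ∈ modes m, ∑ c ∈ modes m, if a + b + c = 0 then F a b c else 0

theorem triSum_congr {m : ℕ} {F G : ℤ → ℤ → ℤ → M}
    (h : ∀ a ∈ modes m, ∀ b ∈ modes m, ∀ c ∈ modes m, a + b + c = 0 → F a b c = G a b c) :
    triSum m F = triSum m G :=
  Finset.sum_congr rfl fun a ha => Finset.sum_congr rfl fun b hb =>
    Finset.sum_congr rfl fun c hc => by
      split_ifs with h0
      · exact h a ha b hb c hc h0
      · rfl

theorem triSum_rotate (m : ℕ) (F : ℤ → ℤ → ℤ → M) :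
    triSum m (fun a b c => F b c a) = triSum m F := by
  unfold triSum
  rw [Finset.sum_comm]
  refine Finset.sum_congr rfl fun b _ => ?_
  rw [Finset.sum_comm]
  refine Finset.sum_congr rfl fun c _ => Finset.sum_congr rfl fun a _ => ?_
  rw [show a + b + c = b + c + a by ring]

theorem triSum_add (m : ℕ) (F G : ℤ → ℤ → ℤ → M) :
    triSum m (fun a b c => F a b c + G a b c) = triSum m F + triSum m G := by
  simp only [triSum, ← Finset.sum_add_distrib]
  refine Finset.sum_congr rfl fun a _ => Finset.sum_congr rfl fun b _ =>
    Finset.sum_congr rfl fun c _ => ?_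
  split_ifs <;> simp

theorem mul_triSum {R : Type*} [Semiring R] (m : ℕ) (r : R) (F : ℤ → ℤ → ℤ → R) :
    r * triSum m F = triSum m (fun a b c => r * F a b c) := by
  simp only [triSum, Finset.mul_sum, mul_ite, mul_zero]

theorem triSum_le {m : ℕ} {F G : ℤ → ℤ → ℤ → ℝ}
    (h : ∀ a ∈ modes m, ∀ b ∈ modes m, ∀ c ∈ modes m, a + b + c = 0 → F a b c ≤ G a b c) :
    triSum m F ≤ triSum m G :=
  Finset.sum_le_sum fun a ha => Finset.sum_le_sum fun b hb =>
    Finset.sum_le_sum fun c hc => by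
      split_ifs with h0
      · exact h a ha b hb c hc h0
      · rfl

theorem norm_triSum_le (m : ℕ) (F : ℤ → ℤ → ℤ → ℂ) :
    ‖triSum m F‖ ≤ triSum m (fun a b c => ‖F a b c‖) :=
  norm_sum_le_of_le _ fun a _ => norm_sum_le_of_le _ fun b _ => norm_sum_le_of_le _ fun c _ => by
    split_ifs <;> simp

theorem triSum_le_sum_sum (m : ℕ) (H : ℤ → ℤ → ℝ)
    (hH : ∀ a ∈ modes m, ∀ b ∈ modes m, 0 ≤ H a b) :
    triSum m (fun a b _ => H a b) ≤ ∑ a ∈ modes m, ∑ b ∈ modes m, H a b := by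
  refine Finset.sum_le_sum fun a ha => Finset.sum_le_sum fun b hb => ?_
  have : ∀ c : ℤ, (a + b + c = 0) = (c = -(a + b)) := fun c => by
    apply propext; constructor <;> intro h <;> linarith
  simp_rw [this, Finset.sum_ite_eq']
  split_ifs
  · rfl
  · exact hH a ha b hb

/-- The convolution over nonzero frequencies of modulus at most `m`. -/
noncomputable def modeConv (m : ℕ) (f g : ℤ → ℝ) (k : ℤ) : ℝ :=
  ∑ a ∈ modes m, ∑ b ∈ modes m, if a + b = k then f a * g b else 0

theorem modeConv_le (m : ℕ) (f g : ℤ → ℝ) (k : ℤ) :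
    modeConv m f g k ≤ √(∑ a ∈ modes m, f a ^ 2) * √(∑ b ∈ modes m, g b ^ 2) := by
  have h0 : modeConv m f g k =
      ∑ p ∈ (modes m ×ˢ modes m).filter (fun p => p.1 + p.2 = k), f p.1 * g p.2 := by
    rw [modeConv, Finset.sum_filter, Finset.sum_product]
  rw [h0]
  refine (Real.sum_mul_le_sqrt_mul_sqrt _ _ _).trans ?_
  gcongr
  · rw [Finset.sum_filter, Finset.sum_product]
    refine Finset.sum_le_sum fun a _ => ?_
    simp_rw [← eq_sub_iff_add_eq', Finset.sum_ite_eq']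
    split_ifs
    · rfl
    · positivity
  · rw [Finset.sum_filter, Finset.sum_product_right]
    refine Finset.sum_le_sum fun b _ => ?_
    simp_rw [← eq_sub_iff_add_eq, Finset.sum_ite_eq']
    split_ifs
    · rfl
    · positivity

theorem modeConv_nonneg (m : ℕ) {f g : ℤ → ℝ} (hf : ∀ k, 0 ≤ f k) (hg : ∀ k, 0 ≤ g k) (k : ℤ) :
    0 ≤ modeConv m f g k :=
  Finset.sum_nonneg fun a _ => Finset.sum_nonneg fun b _ => by
    split_ifs
    · exact mul_nonneg (hf a) (hg b)
    · rfl

end Sums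

/-! ### Bounds for the quartic and cubic terms -/

theorem abs_add_rpow_le {s : ℝ} (hs : 0 < s) (x y : ℝ) :
    |x + y| ^ s ≤ 2 ^ s * (|x| ^ s + |y| ^ s) := by
  have h1 : |x + y| ≤ 2 * max |x| |y| := by
    refine (abs_add_le x y).trans ?_
    linarith [le_max_left |x| |y|, le_max_right |x| |y|]
  refine (Real.rpow_le_rpow (abs_nonneg _) h1 hs.le).trans ?_
  rw [Real.mul_rpow (by norm_num) (le_max_of_le_left (abs_nonneg _))]
  have hx := Real.rpow_nonneg (abs_nonneg x) s
  have hy := Real.rpow_nonneg (abs_nonneg y) s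
  gcongr
  rcases max_choice |x| |y| with h | h <;> rw [h] <;> linarith

theorem rpow_mul_modeConv_le {s : ℝ} (hs : 0 < s) (m : ℕ) {g : ℤ → ℝ} (hg : ∀ k, 0 ≤ g k)
    (k : ℤ) :
    |(k : ℝ)| ^ s * modeConv m g g k ≤
      2 ^ s * 2 * (√(∑ a ∈ modes m, (|(a : ℝ)| ^ s * g a) ^ 2) * √(∑ b ∈ modes m, g b ^ 2)) := by
  have h : |(k : ℝ)| ^ s * modeConv m g g k ≤
      2 ^ s * (modeConv m (fun a => |(a : ℝ)| ^ s * g a) g k +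
        modeConv m g (fun a => |(a : ℝ)| ^ s * g a) k) := by
    simp only [modeConv, ← Finset.sum_add_distrib, Finset.mul_sum]
    refine Finset.sum_le_sum fun a _ => Finset.sum_le_sum fun b _ => ?_
    split_ifs with hab
    · have := abs_add_rpow_le hs (a : ℝ) b
      rw [← Int.cast_add, hab] at this
      calc _ ≤ 2 ^ s * (|(a : ℝ)| ^ s + |(b : ℝ)| ^ s) * (g a * g b) :=
            mul_le_mul_of_nonneg_right this (mul_nonneg (hg a) (hg b))
        _ = _ := by ring
    · simp
  refine h.trans ?_
  have h1 := modeConv_le m (fun a => |(a : ℝ)| ^ s * g a) g k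
  have h2 := modeConv_le m g (fun a => |(a : ℝ)| ^ s * g a) k
  calc _ ≤ 2 ^ s * (√(∑ a ∈ modes m, (|(a : ℝ)| ^ s * g a) ^ 2) * √(∑ b ∈ modes m, g b ^ 2) +
      √(∑ b ∈ modes m, g b ^ 2) * √(∑ a ∈ modes m, (|(a : ℝ)| ^ s * g a) ^ 2)) := by
        gcongr
    _ = _ := by ring

/-- The symbol `a|a|^{2s} + b|b|^{2s} + c|c|^{2s}` produced by symmetrizing the time derivative of
the `Ḣ^s` energy. -/
noncomputable def symbol (s : ℝ) (a b c : ℤ) : ℝ :=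
  a * |(a : ℝ)| ^ (2 * s) + b * |(b : ℝ)| ^ (2 * s) + c * |(c : ℝ)| ^ (2 * s)

theorem symbol_swap (s : ℝ) (a b c : ℤ) : symbol s b a c = symbol s a b c := by
  unfold symbol; ring

theorem symbol_rotate (s : ℝ) (a b c : ℤ) : symbol s b c a = symbol s a b c := by
  unfold symbol; ring

theorem symbol_zero {a b c : ℤ} (h : a + b + c = 0) : symbol 0 a b c = 0 := by
  unfold symbol
  simp only [mul_zero, Real.rpow_zero, mul_one]
  exact_mod_cast h

/-- The `Ḣ^s` energy of the modes of modulus at most `m`. -/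
noncomputable def modeEnergy (s : ℝ) (m : ℕ) (g : ℤ → ℝ) : ℝ :=
  ∑ k ∈ modes m, |(k : ℝ)| ^ (2 * s) * g k ^ 2

theorem modeEnergy_nonneg (s : ℝ) (m : ℕ) (g : ℤ → ℝ) : 0 ≤ modeEnergy s m g :=
  Finset.sum_nonneg fun _ _ => by positivity

theorem sum_rpow_mul_sq (s : ℝ) (m : ℕ) (g : ℤ → ℝ) :
    ∑ a ∈ modes m, (|(a : ℝ)| ^ s * g a) ^ 2 = modeEnergy s m g :=
  Finset.sum_congr rfl fun a _ => by
    rw [mul_pow, ← Real.rpow_natCast, ← Real.rpow_mul (abs_nonneg _)]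
    congr 2; push_cast; ring

/-- The quartic term in the time derivative of the modified energy is bounded by the energy, with
a constant that depends on `g` only through a bound `B` on its `ℓ²` norm. -/
theorem exists_quartic_le {s B : ℝ} (hs : 0 < s) (hB : 0 ≤ B) :
    ∃ C : ℝ, 0 ≤ C ∧ ∀ (m : ℕ) (g : ℤ → ℝ), (∀ k, 0 ≤ g k) → ∑ k ∈ modes m, g k ^ 2 ≤ B ^ 2 →
      triSum m (fun a b c => |symbol s a b c| * (|(a : ℝ)|⁻¹ * |(b : ℝ)|⁻¹) * (g a * g b) *
        modeConv m g g c) ≤ C * modeEnergy s m g := by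
  set D : ℝ := (max 1 (2 * s) + 1) * 2 ^ (2 * s) * 2 ^ s with hD
  have hD0 : 0 ≤ D := by positivity
  refine ⟨2 * (2 + 6 * D ^ 2 * (B ^ 4 + (2 ^ s * 2) ^ 2 * B ^ 4)), by positivity, ?_⟩
  intro m g hg hgB
  set V : ℝ := √(modeEnergy s m g) with hV
  have hV0 : 0 ≤ V := Real.sqrt_nonneg _
  have hVsq : V ^ 2 = modeEnergy s m g := Real.sq_sqrt (modeEnergy_nonneg s m g)
  have hsq : √(∑ k ∈ modes m, g k ^ 2) ≤ B := by
    rw [Real.sqrt_le_left hB]; exact hgB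
  have hW0 : ∀ k, 0 ≤ modeConv m g g k := modeConv_nonneg m hg hg
  have hW : ∀ k, modeConv m g g k ≤ B ^ 2 := fun k => by
    refine (modeConv_le m g g k).trans ?_
    rw [sq]; gcongr
  have hWs : ∀ k : ℤ, |(k : ℝ)| ^ s * modeConv m g g k ≤ 2 ^ s * 2 * (V * B) := fun k => by
    refine (rpow_mul_modeConv_le hs m hg k).trans ?_
    rw [sum_rpow_mul_sq]
    gcongr
  set f : ℤ → ℝ := fun k => |(k : ℝ)| ^ s * g k with hf
  set h : ℤ → ℝ := fun k => D * (B ^ 2 * f k + 2 ^ s * 2 * (V * B) * g k) with hh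
  have hf0 : ∀ k, 0 ≤ f k := fun k => mul_nonneg (by positivity) (hg k)
  have hh0 : ∀ k, 0 ≤ h k := fun k => by
    have := hf0 k; have := hg k; simp only [hh]; positivity
  set H : ℤ → ℤ → ℝ := fun a b =>
    if |(b : ℝ)| ≤ |(a : ℝ)| then |(a : ℝ)|⁻¹ * (f a * h b) else 0 with hH
  have hH0 : ∀ a b, 0 ≤ H a b := fun a b => by
    have := hf0 a; have := hh0 b
    simp only [hH]; split_ifs <;> positivity
  -- `|a|^{2s}` is split as `|a|^s |a|^s`: one factor goes to `g a`, the other, by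
  -- `|a|^s ≲ |b|^s + |c|^s`, either to `g b` or to the convolution at `c`
  have key : ∀ a ∈ modes m, ∀ b ∈ modes m, ∀ c ∈ modes m, a + b + c = 0 →
      |(b : ℝ)| ≤ |(a : ℝ)| →
      |symbol s a b c| * (|(a : ℝ)|⁻¹ * |(b : ℝ)|⁻¹) * (g a * g b) * modeConv m g g c ≤
        H a b := by
    intro a ha b hb c hc habc hba
    have habc' : (a : ℝ) + b + c = 0 := by exact_mod_cast habc
    have ha1 := one_le_abs_of_mem_modes ha
    have hb1 := one_le_abs_of_mem_modes hb
    have h1 := abs_symbol_le (p := 2 * s) (by positivity) habc' hba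
    simp only [hH, if_pos hba]
    have h2 : |(a : ℝ)| ^ s ≤ 2 ^ s * (|(b : ℝ)| ^ s + |(c : ℝ)| ^ s) := by
      have e : (a : ℝ) = -(b + c) := by linarith
      rw [e, abs_neg]
      exact abs_add_rpow_le hs _ _
    have h3 : |(a : ℝ)| ^ (2 * s) = |(a : ℝ)| ^ s * |(a : ℝ)| ^ s := by
      rw [two_mul, Real.rpow_add_of_nonneg (abs_nonneg _) hs.le hs.le]
    have hga := hg a
    have hgb := hg b
    have hW0c := hW0 c
    have hWc := hW c
    have hWsc := hWs c
    calc _ ≤ ((max 1 (2 * s) + 1) * 2 ^ (2 * s) * |(b : ℝ)| * |(a : ℝ)| ^ (2 * s)) *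
          (|(a : ℝ)|⁻¹ * |(b : ℝ)|⁻¹) * (g a * g b) * modeConv m g g c := by
          unfold symbol; gcongr
      _ = ((max 1 (2 * s) + 1) * 2 ^ (2 * s)) * |(a : ℝ)|⁻¹ * f a * g b *
          (|(a : ℝ)| ^ s * modeConv m g g c) := by
          rw [h3]; simp only [hf]; field_simp
      _ ≤ ((max 1 (2 * s) + 1) * 2 ^ (2 * s)) * |(a : ℝ)|⁻¹ * f a * g b *
          ((2 ^ s * (|(b : ℝ)| ^ s + |(c : ℝ)| ^ s)) * modeConv m g g c) := by
          have := hf0 a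
          gcongr
      _ = D * |(a : ℝ)|⁻¹ * f a * g b *
          (|(b : ℝ)| ^ s * modeConv m g g c + |(c : ℝ)| ^ s * modeConv m g g c) := by
          rw [hD]; ring
      _ ≤ D * |(a : ℝ)|⁻¹ * f a * g b * (|(b : ℝ)| ^ s * B ^ 2 + 2 ^ s * 2 * (V * B)) := by
          have := hf0 a
          gcongr
      _ = _ := by simp only [hh, hf]; ring
  have hsum : ∑ a ∈ modes m, ∑ b ∈ modes m, H a b ≤
      (2 + 6 * D ^ 2 * (B ^ 4 + (2 ^ s * 2) ^ 2 * B ^ 4)) * modeEnergy s m g := by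
    refine (hardy_modes m f h).trans ?_
    have e1 : ∑ a ∈ modes m, f a ^ 2 = V ^ 2 := by rw [hVsq]; exact sum_rpow_mul_sq s m g
    have e2 : ∑ b ∈ modes m, h b ^ 2 ≤
        ∑ b ∈ modes m, (2 * D ^ 2 * B ^ 4 * f b ^ 2 +
          2 * D ^ 2 * ((2 ^ s * 2) ^ 2 * (V * B) ^ 2) * g b ^ 2) := by
      refine Finset.sum_le_sum fun b _ => ?_
      simp only [hh]
      have := mul_nonneg (sq_nonneg D)
        (sq_nonneg (B ^ 2 * f b - 2 ^ s * 2 * (V * B) * g b))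
      nlinarith
    rw [Finset.sum_add_distrib, ← Finset.mul_sum, ← Finset.mul_sum, e1] at e2
    rw [e1, ← hVsq]
    have e3 : 2 * D ^ 2 * ((2 ^ s * 2) ^ 2 * (V * B) ^ 2) * ∑ b ∈ modes m, g b ^ 2 ≤
        2 * D ^ 2 * ((2 ^ s * 2) ^ 2 * (V * B) ^ 2) * B ^ 2 := by gcongr
    linarith
  calc _ ≤ triSum m (fun a b _ => H a b + H b a) := by
        refine triSum_le fun a ha b hb c hc habc => ?_
        rcases le_total |(b : ℝ)| |(a : ℝ)| with hle | hle
        · exact (key a ha b hb c hc habc hle).trans (by linarith [hH0 b a])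
        · refine le_trans (le_of_eq ?_) ((key b hb a ha c hc (by linarith) hle).trans
            (by linarith [hH0 a b]))
          rw [symbol_swap]; ring
    _ ≤ ∑ a ∈ modes m, ∑ b ∈ modes m, (H a b + H b a) :=
        triSum_le_sum_sum m _ fun a _ b _ => add_nonneg (hH0 a b) (hH0 b a)
    _ = 2 * ∑ a ∈ modes m, ∑ b ∈ modes m, H a b := by
        simp_rw [Finset.sum_add_distrib]
        rw [Finset.sum_comm (f := fun a b => H b a)]; ring
    _ ≤ _ := by linarith

/-- Interpolation for the weights: a loss of half a derivative makes the top order arbitrarily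
small, up to a constant. -/
theorem exists_rpow_sub_half_le (s : ℝ) (hs : 0 < s) {ε : ℝ} (hε : 0 < ε) :
    ∃ K : ℝ, 0 ≤ K ∧ ∀ x : ℝ, 1 ≤ x → x ^ (2 * s - 1 / 2) ≤ ε * x ^ (2 * s) + K := by
  refine ⟨((ε⁻¹) ^ 2) ^ (2 * s), by positivity, fun x hx => ?_⟩
  have hx0 : 0 < x := by linarith
  rw [Real.rpow_sub hx0, ← Real.sqrt_eq_rpow]
  have hpos : 0 ≤ x ^ (2 * s) := by positivity
  rcases le_total ((ε⁻¹) ^ 2) x with h | h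
  · have h1 : ε⁻¹ ≤ √x := Real.le_sqrt_of_sq_le h
    have h2 : 1 ≤ ε * √x := by
      have := mul_le_mul_of_nonneg_left h1 hε.le
      rwa [mul_inv_cancel₀ hε.ne'] at this
    rw [div_le_iff₀ (by positivity)]
    have : 0 ≤ ((ε⁻¹) ^ 2) ^ (2 * s) * √x := by positivity
    nlinarith
  · have h1 : x ^ (2 * s) ≤ ((ε⁻¹) ^ 2) ^ (2 * s) := by gcongr
    have h2 : x ^ (2 * s) / √x ≤ x ^ (2 * s) := div_le_self hpos (Real.one_le_sqrt.2 hx)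
    have : 0 ≤ ε * x ^ (2 * s) := by positivity
    linarith

/-- Cauchy–Schwarz with the summable weight `|a|^{-3/2}`. -/
theorem sq_sum_rpow_mul_inv_mul_le (s : ℝ) (m : ℕ) (g : ℤ → ℝ) :
    (∑ a ∈ modes m, |(a : ℝ)| ^ s * |(a : ℝ)|⁻¹ * g a) ^ 2 ≤
      6 * ∑ a ∈ modes m, |(a : ℝ)| ^ (2 * s - 1 / 2) * g a ^ 2 := by
  have h1 := Finset.sum_mul_sq_le_sq_mul_sq (modes m) (fun a : ℤ => |(a : ℝ)| ^ (-(3 / 4) : ℝ))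
    (fun a => |(a : ℝ)| ^ (s - 1 / 4) * g a)
  have e0 : ∑ a ∈ modes m, |(a : ℝ)| ^ s * |(a : ℝ)|⁻¹ * g a =
      ∑ a ∈ modes m, |(a : ℝ)| ^ (-(3 / 4) : ℝ) * (|(a : ℝ)| ^ (s - 1 / 4) * g a) := by
    refine Finset.sum_congr rfl fun a ha => ?_
    have ha1 : 0 < |(a : ℝ)| := by linarith [one_le_abs_of_mem_modes ha]
    rw [← Real.rpow_neg_one, ← Real.rpow_add ha1, ← mul_assoc, ← Real.rpow_add ha1]
    congr 2; ring
  have e1 : ∑ a ∈ modes m, (|(a : ℝ)| ^ (-(3 / 4) : ℝ)) ^ 2 ≤ 6 := by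
    refine le_trans (le_of_eq ?_) (sum_modes_rpow_neg_three_half_le m)
    refine Finset.sum_congr rfl fun a ha => ?_
    rw [← Real.rpow_natCast, ← Real.rpow_mul (abs_nonneg _)]
    norm_num
  have e2 : ∑ a ∈ modes m, (|(a : ℝ)| ^ (s - 1 / 4) * g a) ^ 2 =
      ∑ a ∈ modes m, |(a : ℝ)| ^ (2 * s - 1 / 2) * g a ^ 2 := by
    refine Finset.sum_congr rfl fun a ha => ?_
    rw [mul_pow, ← Real.rpow_natCast, ← Real.rpow_mul (abs_nonneg _)]
    congr 2; push_cast; ring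
  rw [e0]
  refine h1.trans ?_
  rw [e2]
  gcongr

/-- In each triple the symbol gains the smallest frequency, so the two other factors keep the weight
`|k|^{s-1}`, and the remaining one is bounded by `B`. -/
theorem triSum_cubic_le_sq {s B : ℝ} (hs : 0 < s) (hB : 0 ≤ B) (m : ℕ) {g : ℤ → ℝ}
    (hg : ∀ k, 0 ≤ g k) (hgB : ∀ k ∈ modes m, g k ≤ B) :
    triSum m (fun a b c => |symbol s a b c| * (|(a : ℝ)|⁻¹ * |(b : ℝ)|⁻¹ * |(c : ℝ)|⁻¹) *
      (g a * g b * g c)) ≤ 3 * ((max 1 (2 * s) + 1) * 2 ^ (2 * s) * 2 ^ s * B *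
        (∑ a ∈ modes m, |(a : ℝ)| ^ s * |(a : ℝ)|⁻¹ * g a) ^ 2) := by
  obtain ⟨D, hD⟩ : ∃ D : ℝ, D = (max 1 (2 * s) + 1) * 2 ^ (2 * s) * 2 ^ s := ⟨_, rfl⟩
  have hD0 : 0 ≤ D := by rw [hD]; positivity
  obtain ⟨α, hα⟩ : ∃ α : ℤ → ℝ, ∀ k, α k = |(k : ℝ)| ^ s * |(k : ℝ)|⁻¹ * g k := ⟨_, fun _ => rfl⟩
  have hα0 : ∀ k, 0 ≤ α k := fun k => by have := hg k; rw [hα]; positivity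
  obtain ⟨F, hF⟩ : ∃ F : ℤ → ℤ → ℤ → ℝ, ∀ a b c, F a b c = D * B * (α a * α b) :=
    ⟨fun a b _ => _, fun _ _ _ => rfl⟩
  have hF0 : ∀ a b c, 0 ≤ F a b c := fun a b c => by
    have := hα0 a; have := hα0 b; rw [hF]; positivity
  have key : ∀ a ∈ modes m, ∀ b ∈ modes m, ∀ c ∈ modes m, a + b + c = 0 →
      |(c : ℝ)| ≤ |(a : ℝ)| → |(c : ℝ)| ≤ |(b : ℝ)| →
      |symbol s a b c| * (|(a : ℝ)|⁻¹ * |(b : ℝ)|⁻¹ * |(c : ℝ)|⁻¹) * (g a * g b * g c) ≤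
        F a b c := by
    intro a ha b hb c hc habc hca hcb
    have habc' : (a : ℝ) + b + c = 0 := by exact_mod_cast habc
    have h1 := abs_symbol_le_of_min hs habc' hca hcb
    rw [← hD] at h1
    have hc1 := one_le_abs_of_mem_modes hc
    have hc2 : |(c : ℝ)| * |(c : ℝ)|⁻¹ = 1 := mul_inv_cancel₀ (by linarith)
    have hga := hg a
    have hgb := hg b
    have hgc := hg c
    have hα0a := hα0 a
    have hα0b := hα0 b
    calc _ ≤ (D * |(c : ℝ)| * (|(a : ℝ)| ^ s * |(b : ℝ)| ^ s)) *
          (|(a : ℝ)|⁻¹ * |(b : ℝ)|⁻¹ * |(c : ℝ)|⁻¹) * (g a * g b * g c) := by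
          unfold symbol; gcongr
      _ = D * (α a * α b) * g c * (|(c : ℝ)| * |(c : ℝ)|⁻¹) := by rw [hα, hα]; ring
      _ = D * (α a * α b) * g c := by rw [hc2, mul_one]
      _ ≤ D * (α a * α b) * B := by gcongr; exact hgB c hc
      _ = _ := by rw [hF]; ring
  have hsum : triSum m F ≤ D * B * (∑ a ∈ modes m, α a) ^ 2 := by
    have e : triSum m F = triSum m fun a b _ => D * B * (α a * α b) :=
      triSum_congr fun a _ b _ c _ _ => hF a b c
    rw [e]
    refine (triSum_le_sum_sum m (fun a b => D * B * (α a * α b))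
      fun a _ b _ => hF a b 0 ▸ hF0 a b 0).trans (le_of_eq ?_)
    simp_rw [← Finset.mul_sum, ← Finset.sum_mul]
    ring
  simp_rw [← hα, ← hD]
  calc _ ≤ triSum m (fun a b c => F a b c + F b c a + F c a b) := by
        refine triSum_le fun a ha b hb c hc habc => ?_
        rcases le_total |(a : ℝ)| |(b : ℝ)| with h1 | h1
        · rcases le_total |(a : ℝ)| |(c : ℝ)| with h2 | h2
          · refine le_trans (le_of_eq ?_) ((key b hb c hc a ha (by linarith) h1 h2).trans
              (by linarith [hF0 a b c, hF0 c a b]))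
            rw [symbol_rotate s a b c]; ring
          · exact (key a ha b hb c hc habc h2 (h2.trans h1)).trans
              (by linarith [hF0 b c a, hF0 c a b])
        · rcases le_total |(b : ℝ)| |(c : ℝ)| with h2 | h2
          · refine le_trans (le_of_eq ?_) ((key c hc a ha b hb (by linarith) h2 h1).trans
              (by linarith [hF0 a b c, hF0 b c a]))
            rw [← symbol_rotate s c a b]; ring
          · exact (key a ha b hb c hc habc (h2.trans h1) h2).trans
              (by linarith [hF0 b c a, hF0 c a b])
    _ = 3 * triSum m F := by
        rw [triSum_add, triSum_add, triSum_rotate m F,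
          triSum_rotate m (fun a b c => F b c a), triSum_rotate m F]
        ring
    _ ≤ _ := by gcongr

/-- The cubic correction of the energy is of lower order: it is at most half the energy plus a
constant that depends only on a bound `B` on the `ℓ²` norm. -/
theorem exists_cubic_le {s B : ℝ} (hs : 0 < s) (hB : 0 ≤ B) :
    ∃ K : ℝ, 0 ≤ K ∧ ∀ (m : ℕ) (g : ℤ → ℝ), (∀ k, 0 ≤ g k) → ∑ k ∈ modes m, g k ^ 2 ≤ B ^ 2 →
      triSum m (fun a b c => |symbol s a b c| * (|(a : ℝ)|⁻¹ * |(b : ℝ)|⁻¹ * |(c : ℝ)|⁻¹) *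
        (g a * g b * g c)) ≤ 1 / 2 * modeEnergy s m g + K := by
  obtain ⟨D, hD⟩ : ∃ D : ℝ, D = (max 1 (2 * s) + 1) * 2 ^ (2 * s) * 2 ^ s := ⟨_, rfl⟩
  have hD0 : 0 ≤ D := by rw [hD]; positivity
  obtain ⟨E, hE⟩ : ∃ E : ℝ, E = D * 3 * B * 6 := ⟨_, rfl⟩
  have hE0 : 0 ≤ E := by rw [hE]; positivity
  -- `ε` is chosen so that the final coefficient `E ε` of the energy is at most `1 / 2`
  obtain ⟨K, hK0, hK⟩ := exists_rpow_sub_half_le s hs (ε := 1 / (2 * (E + 1))) (by positivity)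
  refine ⟨E * (K * B ^ 2), by positivity, ?_⟩
  intro m g hg hgB
  have hgB' : ∀ k ∈ modes m, g k ≤ B := fun k hk => by
    refine abs_le_of_sq_le_sq' ?_ hB |>.2
    exact (Finset.single_le_sum (f := fun k => g k ^ 2) (fun _ _ => sq_nonneg _) hk).trans hgB
  have hint : ∑ a ∈ modes m, |(a : ℝ)| ^ (2 * s - 1 / 2) * g a ^ 2 ≤
      1 / (2 * (E + 1)) * modeEnergy s m g + K * B ^ 2 := by
    calc _ ≤ ∑ a ∈ modes m, (1 / (2 * (E + 1)) * |(a : ℝ)| ^ (2 * s) + K) * g a ^ 2 := by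
          refine Finset.sum_le_sum fun a ha => ?_
          gcongr
          exact hK _ (one_le_abs_of_mem_modes ha)
      _ = 1 / (2 * (E + 1)) * modeEnergy s m g + K * ∑ a ∈ modes m, g a ^ 2 := by
          rw [modeEnergy, Finset.mul_sum, Finset.mul_sum, ← Finset.sum_add_distrib]
          exact Finset.sum_congr rfl fun a _ => by ring
      _ ≤ _ := by gcongr
  refine (triSum_cubic_le_sq hs hB m hg hgB').trans ?_
  rw [← hD]
  calc _ ≤ 3 * (D * B * (6 * (1 / (2 * (E + 1)) * modeEnergy s m g + K * B ^ 2))) := by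
        gcongr
        exact (sq_sum_rpow_mul_inv_mul_le s m g).trans (by gcongr)
    _ = E / (E + 1) * (1 / 2 * modeEnergy s m g) + E * (K * B ^ 2) := by
        have : E + 1 ≠ 0 := by positivity
        rw [show 3 * (D * B * (6 * (1 / (2 * (E + 1)) * modeEnergy s m g + K * B ^ 2))) =
          D * 3 * B * 6 * (1 / (2 * (E + 1)) * modeEnergy s m g + K * B ^ 2) by ring, ← hE]
        field_simp
    _ ≤ _ := by
        have h1 : E / (E + 1) ≤ 1 := by rw [div_le_one (by positivity)]; linarith
        have h2 := modeEnergy_nonneg s m g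
        have h3 := mul_le_mul_of_nonneg_right h1 (show 0 ≤ 1 / 2 * modeEnergy s m g by positivity)
        linarith

/-! ### The Galerkin vector field and its energy identities -/

/-- The right-hand side of the Galerkin system at the frequency `k`, for sequences indexed by all
integers. -/
noncomputable def field (m : ℕ) (t : ℝ) (u : ℤ → ℂ) (k : ℤ) : ℂ :=
  1 / 2 * Complex.I * (k : ℂ) * ∑ a ∈ modes m, ∑ b ∈ modes m,
    if a + b = k then
      Complex.exp (Complex.I * 3 * (k : ℂ) * (a : ℂ) * (b : ℂ) * (t : ℂ)) * u a * u b else 0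

theorem norm_field_le (m : ℕ) (t : ℝ) (u : ℤ → ℂ) (k : ℤ) :
    ‖field m t u k‖ ≤ 1 / 2 * |(k : ℝ)| * modeConv m (fun k => ‖u k‖) (fun k => ‖u k‖) k := by
  unfold field modeConv
  rw [norm_mul]
  refine mul_le_mul (le_of_eq ?_) ?_ (norm_nonneg _) (by positivity)
  · simp
  · refine norm_sum_le_of_le _ fun a _ => norm_sum_le_of_le _ fun b _ => ?_
    split_ifs
    · rw [norm_mul, norm_mul]
      have : ‖Complex.exp (Complex.I * 3 * (k : ℂ) * (a : ℂ) * (b : ℂ) * (t : ℂ))‖ = 1 := by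
        have e : Complex.I * 3 * (k : ℂ) * (a : ℂ) * (b : ℂ) * (t : ℂ) =
          ((3 * k * a * b * t : ℝ) : ℂ) * Complex.I := by push_cast; ring
        rw [e, Complex.norm_exp_ofReal_mul_I]
      rw [this, one_mul]
    · simp

/-- The oscillating factor `e^{-3iabct}` attached to a triple `a + b + c = 0`. -/
noncomputable def phase (t : ℝ) (a b c : ℤ) : ℂ :=
  Complex.exp (-(3 * Complex.I * (a : ℂ) * (b : ℂ) * (c : ℂ)) * (t : ℂ))

theorem phase_rotate (t : ℝ) (a b c : ℤ) : phase t b c a = phase t a b c := by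
  unfold phase; congr 1; ring

theorem norm_phase (t : ℝ) (a b c : ℤ) : ‖phase t a b c‖ = 1 := by
  have e : -(3 * Complex.I * (a : ℂ) * (b : ℂ) * (c : ℂ)) * (t : ℂ) =
    ((-3 * a * b * c * t : ℝ) : ℂ) * Complex.I := by push_cast; ring
  rw [phase, e, Complex.norm_exp_ofReal_mul_I]

theorem hasDerivAt_phase (t : ℝ) (a b c : ℤ) :
    HasDerivAt (fun τ => phase τ a b c)
      (-(3 * Complex.I * (a : ℂ) * (b : ℂ) * (c : ℂ)) * phase t a b c) t := by
  unfold phase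
  have h := ((hasDerivAt_id (t : ℂ)).const_mul
    (-(3 * Complex.I * (a : ℂ) * (b : ℂ) * (c : ℂ)))).cexp.comp_ofReal
  refine h.congr_deriv ?_
  simp [mul_comm]

/-- Symmetrization of the time derivative of the energy over triples with zero sum. -/
theorem sum_field_mul (s : ℝ) (m : ℕ) (t : ℝ) (u : ℤ → ℂ) :
    ∑ k ∈ modes m, ((|(k : ℝ)| ^ (2 * s) : ℝ) : ℂ) * (field m t u k * u (-k)) =
      -(Complex.I / 6) * triSum m (fun a b c =>
        ((symbol s a b c : ℝ) : ℂ) * phase t a b c * (u a * u b * u c)) := by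
  set G : ℤ → ℤ → ℤ → ℂ := fun a b c =>
    (a : ℂ) * ((|(a : ℝ)| ^ (2 * s) : ℝ) : ℂ) * phase t a b c * (u a * u b * u c) with hG
  have h1 : ∑ k ∈ modes m, ((|(k : ℝ)| ^ (2 * s) : ℝ) : ℂ) * (field m t u k * u (-k)) =
      -(Complex.I / 2) * triSum m G := by
    rw [← sum_modes_neg, triSum, Finset.mul_sum]
    refine Finset.sum_congr rfl fun c _ => ?_
    simp only [field, neg_neg, Finset.mul_sum, Finset.sum_mul]
    refine Finset.sum_congr rfl fun a _ => Finset.sum_congr rfl fun b _ => ?_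
    have hiff : a + b = -c ↔ c + a + b = 0 := by constructor <;> intro h <;> linarith
    simp only [hiff]
    split_ifs
    · simp only [hG, phase]
      push_cast
      rw [abs_neg, show Complex.I * 3 * -(c : ℂ) * (a : ℂ) * (b : ℂ) * (t : ℂ) =
        -(3 * Complex.I * (c : ℂ) * (a : ℂ) * (b : ℂ)) * (t : ℂ) by ring]
      ring
    · simp
  have h2 : triSum m (fun a b c =>
      ((symbol s a b c : ℝ) : ℂ) * phase t a b c * (u a * u b * u c)) = 3 * triSum m G := by
    have e : triSum m (fun a b c =>
        ((symbol s a b c : ℝ) : ℂ) * phase t a b c * (u a * u b * u c)) =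
        triSum m (fun a b c => G a b c + G b c a + G c a b) := by
      refine triSum_congr fun a _ b _ c _ _ => ?_
      simp only [hG, symbol]
      rw [phase_rotate t a b c, ← phase_rotate t c a b]
      push_cast; ring
    rw [e, triSum_add, triSum_add, triSum_rotate m G, triSum_rotate m (fun a b c => G b c a),
      triSum_rotate m G]
    ring
  rw [h1, h2]; ring

/-- The quadratic energy `∑ |k|^{2s} u_k u_{-k}`; for real sequences it is `modeEnergy`. -/
noncomputable def quadEnergy (s : ℝ) (m : ℕ) (u : ℤ → ℂ) : ℂ :=
  ∑ k ∈ modes m, ((|(k : ℝ)| ^ (2 * s) : ℝ) : ℂ) * (u k * u (-k))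

theorem quadEnergy_eq (s : ℝ) (m : ℕ) {u : ℤ → ℂ} (hu : ∀ k ∈ modes m, u (-k) = conj (u k)) :
    quadEnergy s m u = (modeEnergy s m (fun k => ‖u k‖) : ℝ) := by
  unfold quadEnergy modeEnergy
  push_cast
  refine Finset.sum_congr rfl fun k hk => ?_
  rw [hu k hk, Complex.mul_conj, Complex.normSq_eq_norm_sq]
  push_cast; rfl

/-- The cubic normal-form correction of the energy. -/
noncomputable def cubicCorrection (s : ℝ) (m : ℕ) (t : ℝ) (u : ℤ → ℂ) : ℂ :=
  triSum m (fun a b c => ((symbol s a b c : ℝ) : ℂ) * ((a : ℂ)⁻¹ * (b : ℂ)⁻¹ * (c : ℂ)⁻¹) *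
    phase t a b c * (u a * u b * u c))

theorem hasDerivWithinAt_triSum {m : ℕ} {F : ℝ → ℤ → ℤ → ℤ → ℂ} {F' : ℤ → ℤ → ℤ → ℂ} {S : Set ℝ}
    {t : ℝ} (h : ∀ a ∈ modes m, ∀ b ∈ modes m, ∀ c ∈ modes m,
      HasDerivWithinAt (fun τ => F τ a b c) (F' a b c) S t) :
    HasDerivWithinAt (fun τ => triSum m (F τ)) (triSum m F') S t := by
  unfold triSum
  refine HasDerivWithinAt.fun_sum fun a ha => HasDerivWithinAt.fun_sum fun b hb =>
    HasDerivWithinAt.fun_sum fun c hc => ?_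
  split_ifs
  · exact h a ha b hb c hc
  · exact hasDerivWithinAt_const t S 0

theorem hasDerivWithinAt_quadEnergy (s : ℝ) {m : ℕ} {u : ℝ → ℤ → ℂ} {θ : ℂ} {S : Set ℝ} {t : ℝ}
    (h : ∀ k ∈ modes m, HasDerivWithinAt (fun τ => u τ k) (θ * field m t (u t) k) S t) :
    HasDerivWithinAt (fun τ => quadEnergy s m (u τ))
      (θ * (-(Complex.I / 3) * triSum m (fun a b c =>
        ((symbol s a b c : ℝ) : ℂ) * phase t a b c * (u t a * u t b * u t c)))) S t := by
  unfold quadEnergy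
  have h1 : HasDerivWithinAt
      (fun τ => ∑ k ∈ modes m, ((|(k : ℝ)| ^ (2 * s) : ℝ) : ℂ) * (u τ k * u τ (-k)))
      (∑ k ∈ modes m, ((|(k : ℝ)| ^ (2 * s) : ℝ) : ℂ) *
        (θ * field m t (u t) k * u t (-k) + u t k * (θ * field m t (u t) (-k)))) S t :=
    HasDerivWithinAt.fun_sum fun k hk =>
      ((h k hk).mul (h (-k) (neg_mem_modes.2 hk))).const_mul _
  refine h1.congr_deriv ?_
  have e1 := sum_field_mul s m t (u t)
  have e2 : ∑ k ∈ modes m, ((|(k : ℝ)| ^ (2 * s) : ℝ) : ℂ) * (u t k * field m t (u t) (-k)) =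
      ∑ k ∈ modes m, ((|(k : ℝ)| ^ (2 * s) : ℝ) : ℂ) * (field m t (u t) k * u t (-k)) := by
    rw [← sum_modes_neg]
    refine Finset.sum_congr rfl fun k _ => ?_
    rw [neg_neg]; push_cast; rw [abs_neg]; ring
  have e3 : ∑ k ∈ modes m, ((|(k : ℝ)| ^ (2 * s) : ℝ) : ℂ) *
        (θ * field m t (u t) k * u t (-k) + u t k * (θ * field m t (u t) (-k))) =
      θ * (∑ k ∈ modes m, ((|(k : ℝ)| ^ (2 * s) : ℝ) : ℂ) * (field m t (u t) k * u t (-k)) +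
      ∑ k ∈ modes m, ((|(k : ℝ)| ^ (2 * s) : ℝ) : ℂ) * (u t k * field m t (u t) (-k))) := by
    rw [← Finset.sum_add_distrib, Finset.mul_sum]
    exact Finset.sum_congr rfl fun k _ => by ring
  rw [e3, e2, e1]; ring

/-- Differentiation by parts: after subtracting the cubic correction, the time derivative of the
energy is a quartic expression in which the time derivatives of the oscillating factors no longer
appear. -/
theorem hasDerivWithinAt_modifiedEnergy (s : ℝ) {m : ℕ} {u : ℝ → ℤ → ℂ} {S : Set ℝ} {t : ℝ}
    (h : ∀ k ∈ modes m, HasDerivWithinAt (fun τ => u τ k) (field m t (u t) k) S t) :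
    HasDerivWithinAt (fun τ => quadEnergy s m (u τ) - 1 / 9 * cubicCorrection s m τ (u τ))
      (-(1 / 3) * triSum m (fun a b c => ((symbol s a b c : ℝ) : ℂ) *
        ((a : ℂ)⁻¹ * (b : ℂ)⁻¹ * (c : ℂ)⁻¹) * phase t a b c *
        (u t a * u t b * field m t (u t) c))) S t := by
  have h1 := hasDerivWithinAt_quadEnergy s (θ := 1) (u := u) (S := S) (t := t)
    (by simpa using h)
  set P : ℤ → ℤ → ℤ → ℂ := fun a b c =>
    ((symbol s a b c : ℝ) : ℂ) * ((a : ℂ)⁻¹ * (b : ℂ)⁻¹ * (c : ℂ)⁻¹) * phase t a b c with hP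
  set Q : ℤ → ℤ → ℤ → ℂ := fun a b c => P a b c * (u t a * u t b * field m t (u t) c) with hQ
  have hProt : ∀ a b c, P b c a = P a b c := fun a b c => by
    simp only [hP]; rw [symbol_rotate, phase_rotate]; ring
  have h2 : HasDerivWithinAt (fun τ => cubicCorrection s m τ (u τ))
      (triSum m (fun a b c => -(3 * Complex.I) *
        (((symbol s a b c : ℝ) : ℂ) * phase t a b c * (u t a * u t b * u t c)) +
        (Q a b c + Q b c a + Q c a b))) S t := by
    unfold cubicCorrection
    refine hasDerivWithinAt_triSum fun a ha b hb c hc => ?_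
    have d := (((hasDerivAt_phase t a b c).hasDerivWithinAt (s := S)).const_mul
      (((symbol s a b c : ℝ) : ℂ) * ((a : ℂ)⁻¹ * (b : ℂ)⁻¹ * (c : ℂ)⁻¹))).mul
      (((h a ha).mul (h b hb)).mul (h c hc))
    refine d.congr_deriv ?_
    have ha0 : (a : ℂ) ≠ 0 := by exact_mod_cast (mem_modes.1 ha).1
    have hb0 : (b : ℂ) ≠ 0 := by exact_mod_cast (mem_modes.1 hb).1
    have hc0 : (c : ℂ) ≠ 0 := by exact_mod_cast (mem_modes.1 hc).1
    have hPa := hProt a b c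
    have hPc := hProt c a b
    simp only [hQ]
    rw [hPa, ← hPc]
    simp only [hP]
    have e : (a : ℂ)⁻¹ * (b : ℂ)⁻¹ * (c : ℂ)⁻¹ * ((a : ℂ) * (b : ℂ) * (c : ℂ)) = 1 := by
      field_simp
    simp only [Pi.mul_apply]
    linear_combination (-(3 * Complex.I) * ((symbol s a b c : ℝ) : ℂ) * phase t a b c *
      (u t a * u t b * u t c)) * e
  refine (h1.sub (h2.const_mul (1 / 9))).congr_deriv ?_
  rw [triSum_add, triSum_add, triSum_add, triSum_rotate m Q, triSum_rotate m (fun a b c => Q b c a),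
    triSum_rotate m Q, ← mul_triSum]
  ring

theorem norm_cubicCorrection_le (s : ℝ) (m : ℕ) (t : ℝ) (u : ℤ → ℂ) :
    ‖cubicCorrection s m t u‖ ≤ triSum m (fun a b c => |symbol s a b c| *
      (|(a : ℝ)|⁻¹ * |(b : ℝ)|⁻¹ * |(c : ℝ)|⁻¹) * (‖u a‖ * ‖u b‖ * ‖u c‖)) := by
  refine (norm_triSum_le _ _).trans (triSum_le fun a _ b _ c _ _ => le_of_eq ?_)
  simp [norm_phase]

theorem norm_quartic_le (s : ℝ) (m : ℕ) (t : ℝ) (u : ℤ → ℂ) :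
    ‖triSum m (fun a b c => ((symbol s a b c : ℝ) : ℂ) *
        ((a : ℂ)⁻¹ * (b : ℂ)⁻¹ * (c : ℂ)⁻¹) * phase t a b c * (u a * u b * field m t u c))‖ ≤
      triSum m (fun a b c => |symbol s a b c| * (|(a : ℝ)|⁻¹ * |(b : ℝ)|⁻¹) * (‖u a‖ * ‖u b‖) *
        modeConv m (fun k => ‖u k‖) (fun k => ‖u k‖) c) := by
  refine (norm_triSum_le _ _).trans (triSum_le fun a _ b _ c hc _ => ?_)
  have h := norm_field_le m t u c
  have hc1 := one_le_abs_of_mem_modes hc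
  have hc2 : |(c : ℝ)|⁻¹ * |(c : ℝ)| = 1 := inv_mul_cancel₀ (by linarith)
  have hW := modeConv_nonneg m (fun k => norm_nonneg (u k)) (fun k => norm_nonneg (u k)) c
  simp only [norm_mul, norm_phase, norm_inv, Complex.norm_intCast, Complex.norm_real,
    Real.norm_eq_abs, mul_one]
  calc _ ≤ |symbol s a b c| * (|(a : ℝ)|⁻¹ * |(b : ℝ)|⁻¹ * |(c : ℝ)|⁻¹) * (‖u a‖ * ‖u b‖ *
        (1 / 2 * |(c : ℝ)| * modeConv m (fun k => ‖u k‖) (fun k => ‖u k‖) c)) := by gcongr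
    _ = 1 / 2 * (|symbol s a b c| * (|(a : ℝ)|⁻¹ * |(b : ℝ)|⁻¹) * (‖u a‖ * ‖u b‖) *
        modeConv m (fun k => ‖u k‖) (fun k => ‖u k‖) c) * (|(c : ℝ)|⁻¹ * |(c : ℝ)|) := by ring
    _ ≤ _ := by
      rw [hc2, mul_one]
      have : 0 ≤ |symbol s a b c| * (|(a : ℝ)|⁻¹ * |(b : ℝ)|⁻¹) * (‖u a‖ * ‖u b‖) *
        modeConv m (fun k => ‖u k‖) (fun k => ‖u k‖) c := by positivity
      linarith

/-! ### Conservation of mass and the a priori bound -/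

theorem hasDerivWithinAt_Ici_of_Icc {E : Type*} [NormedAddCommGroup E] [NormedSpace ℝ E]
    {f : ℝ → E} {f' : E} {T t : ℝ} (ht : t ∈ Set.Ico 0 T)
    (h : HasDerivWithinAt f f' (Set.Icc 0 T) t) : HasDerivWithinAt f f' (Set.Ici t) t :=
  h.mono_of_mem_nhdsWithin (Icc_mem_nhdsGE_of_mem ht)

theorem modeEnergy_zero (m : ℕ) (g : ℤ → ℝ) : modeEnergy 0 m g = ∑ k ∈ modes m, g k ^ 2 := by
  simp [modeEnergy]

/-- Conservation of the `ℓ²` norm along real solutions; a time-dependent scalar factor `θ` in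
front of the vector field is allowed. -/
theorem sum_norm_sq_eq {m : ℕ} {T : ℝ} {u : ℝ → ℤ → ℂ} {θ : ℝ → ℂ}
    (h : ∀ k ∈ modes m, ∀ t ∈ Set.Icc 0 T,
      HasDerivWithinAt (fun τ => u τ k) (θ t * field m t (u t) k) (Set.Icc 0 T) t)
    (hreal : ∀ t ∈ Set.Icc 0 T, ∀ k ∈ modes m, u t (-k) = conj (u t k)) :
    ∀ t ∈ Set.Icc 0 T, ∑ k ∈ modes m, ‖u t k‖ ^ 2 = ∑ k ∈ modes m, ‖u 0 k‖ ^ 2 := by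
  have hd : ∀ t ∈ Set.Icc 0 T,
      HasDerivWithinAt (fun τ => quadEnergy 0 m (u τ)) 0 (Set.Icc 0 T) t := fun t ht => by
    refine (hasDerivWithinAt_quadEnergy 0 (fun k hk => h k hk t ht)).congr_deriv ?_
    rw [triSum_congr (G := fun _ _ _ => 0) fun a _ b _ c _ habc => by rw [symbol_zero habc]; simp]
    simp [triSum]
  intro t ht
  have h0 : (0 : ℝ) ∈ Set.Icc 0 T := ⟨le_rfl, ht.1.trans ht.2⟩
  have := constant_of_has_deriv_right_zero (fun t ht => (hd t ht).continuousWithinAt)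
    (fun t ht => hasDerivWithinAt_Ici_of_Icc ht (hd t (Set.Ico_subset_Icc_self ht))) t ht
  rw [quadEnergy_eq 0 m (hreal t ht), quadEnergy_eq 0 m (hreal 0 h0)] at this
  have := Complex.ofReal_injective this
  simpa only [modeEnergy_zero] using this

/-- The a priori bound: the `Ḣ^s` energy of a real solution of the Galerkin system stays bounded on
`[0, T]`, uniformly in the truncation. -/
theorem exists_modeEnergy_le {s B : ℝ} (hs : 0 < s) (hB : 0 ≤ B) (T N : ℝ) :
    ∃ C : ℝ, 0 ≤ C ∧ ∀ (m : ℕ) (u : ℝ → ℤ → ℂ),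
      (∀ k ∈ modes m, ∀ t ∈ Set.Icc 0 T,
        HasDerivWithinAt (fun τ => u τ k) (field m t (u t) k) (Set.Icc 0 T) t) →
      (∀ t ∈ Set.Icc 0 T, ∀ k ∈ modes m, u t (-k) = conj (u t k)) →
      ∑ k ∈ modes m, ‖u 0 k‖ ^ 2 ≤ B ^ 2 → modeEnergy s m (fun k => ‖u 0 k‖) ≤ N →
      ∀ t ∈ Set.Icc 0 T, modeEnergy s m (fun k => ‖u t k‖) ≤ C := by
  obtain ⟨C, hC0, hC⟩ := exists_quartic_le hs hB
  obtain ⟨K, hK0, hK⟩ := exists_cubic_le hs hB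
  refine ⟨2 * ((2 * |N| + 2 * K) * Real.exp (2 * C * |T|)), by positivity, ?_⟩
  intro m u h hreal hu0 huN t ht
  set E : ℝ → ℝ := fun t => modeEnergy s m (fun k => ‖u t k‖) with hE
  have hE0 : ∀ t, 0 ≤ E t := fun t => modeEnergy_nonneg _ _ _
  have hmass : ∀ t ∈ Set.Icc 0 T, ∑ k ∈ modes m, ‖u t k‖ ^ 2 ≤ B ^ 2 := fun t ht => by
    rw [sum_norm_sq_eq (θ := fun _ => 1) (by simpa using h) hreal t ht]; exact hu0
  set c : ℝ → ℂ := fun t => cubicCorrection s m t (u t) with hc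
  have hcub : ∀ t ∈ Set.Icc 0 T, ‖1 / 9 * c t‖ ≤ 1 / 2 * E t + K := fun t ht => by
    have h1 := (norm_cubicCorrection_le s m t (u t)).trans
      (hK m (fun k => ‖u t k‖) (fun k => norm_nonneg _) (hmass t ht))
    rw [norm_mul]
    have : ‖(1 / 9 : ℂ)‖ ≤ 1 := by norm_num
    exact (mul_le_of_le_one_left (norm_nonneg _) this).trans h1
  -- the modified energy, made nonnegative by the constant `K`
  set Z : ℝ → ℂ := fun t => quadEnergy s m (u t) - 1 / 9 * c t + (K : ℂ) with hZ
  have hZeq : ∀ t ∈ Set.Icc 0 T, Z t = ((E t + K : ℝ) : ℂ) - 1 / 9 * c t := fun t ht => by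
    simp only [hZ]; rw [quadEnergy_eq s m (hreal t ht)]; push_cast; ring
  have hEZ : ∀ t ∈ Set.Icc 0 T, E t ≤ 2 * ‖Z t‖ := fun t ht => by
    have h1 := norm_sub_norm_le ((E t + K : ℝ) : ℂ) (1 / 9 * c t)
    rw [← hZeq t ht, Complex.norm_real, Real.norm_of_nonneg (by linarith [hE0 t])] at h1
    linarith [hcub t ht]
  have hZE : ∀ t ∈ Set.Icc 0 T, ‖Z t‖ ≤ 2 * E t + 2 * K := fun t ht => by
    have h1 := norm_sub_le ((E t + K : ℝ) : ℂ) (1 / 9 * c t)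
    rw [← hZeq t ht, Complex.norm_real, Real.norm_of_nonneg (by linarith [hE0 t])] at h1
    linarith [hcub t ht, hE0 t]
  have hd : ∀ t ∈ Set.Icc 0 T, HasDerivWithinAt Z _ (Set.Icc 0 T) t := fun t ht =>
    (hasDerivWithinAt_modifiedEnergy s (fun k hk => h k hk t ht)).add_const (K : ℂ)
  have h0 : (0 : ℝ) ∈ Set.Icc 0 T := ⟨le_rfl, ht.1.trans ht.2⟩
  have hg := norm_le_gronwallBound_of_norm_deriv_right_le (K := 2 * C) (ε := 0)
    (fun t ht => (hd t ht).continuousWithinAt)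
    (fun t ht => hasDerivWithinAt_Ici_of_Icc ht (hd t (Set.Ico_subset_Icc_self ht)))
    (hZE 0 h0) (fun t ht => by
      have ht' := Set.Ico_subset_Icc_self ht
      have h1 := (norm_quartic_le s m t (u t)).trans
        (hC m (fun k => ‖u t k‖) (fun k => norm_nonneg _) (hmass t ht'))
      rw [norm_mul]
      have : ‖(-(1 / 3) : ℂ)‖ ≤ 1 := by norm_num
      refine (mul_le_of_le_one_left (norm_nonneg _) this).trans (h1.trans ?_)
      have := mul_le_mul_of_nonneg_left (hEZ t ht') hC0
      simp only [hE] at this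
      linarith) t ht
  rw [gronwallBound_ε0, sub_zero] at hg
  refine (hEZ t ht).trans ?_
  have hN : E 0 ≤ |N| := huN.trans (le_abs_self N)
  have hT : t ≤ |T| := ht.2.trans (le_abs_self T)
  have hE00 := hE0 0
  gcongr
  exact hg.trans (by gcongr)

/-! ### Existence and uniqueness for smooth ordinary differential equations -/

section ODE

variable {E : Type*} [NormedAddCommGroup E] [NormedSpace ℝ E] [FiniteDimensional ℝ E]

theorem exists_lipschitzOnWith_closedBall {F : ℝ → E → E}
    (hF : ContDiff ℝ 1 (Function.uncurry F)) (T : ℝ) (x₀ : E) (R : ℝ) :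
    ∃ K : ℝ≥0, ∀ t ∈ Set.Icc 0 T, LipschitzOnWith K (F t) (Metric.closedBall x₀ R) := by
  have := FiniteDimensional.proper ℝ E
  obtain ⟨K, hK⟩ := ContDiffOn.exists_lipschitzOnWith
    (hF.contDiffOn (s := Set.Icc 0 T ×ˢ Metric.closedBall x₀ R)) one_ne_zero
    ((convex_Icc 0 T).prod (convex_closedBall x₀ R))
    (isCompact_Icc.prod (isCompact_closedBall x₀ R))
  refine ⟨K, fun t ht x hx y hy => ?_⟩
  have := hK (x := (t, x)) ⟨ht, hx⟩ (y := (t, y)) ⟨ht, hy⟩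
  simpa [Function.uncurry, Prod.edist_eq] using this

theorem ode_unique {F : ℝ → E → E} (hF : ContDiff ℝ 1 (Function.uncurry F)) {T : ℝ}
    {x y : ℝ → E} (hx : ∀ t ∈ Set.Icc 0 T, HasDerivWithinAt x (F t (x t)) (Set.Icc 0 T) t)
    (hy : ∀ t ∈ Set.Icc 0 T, HasDerivWithinAt y (F t (y t)) (Set.Icc 0 T) t) (h0 : x 0 = y 0) :
    ∀ t ∈ Set.Icc 0 T, x t = y t := by
  have hxc : ContinuousOn x (Set.Icc 0 T) := fun t ht => (hx t ht).continuousWithinAt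
  have hyc : ContinuousOn y (Set.Icc 0 T) := fun t ht => (hy t ht).continuousWithinAt
  obtain ⟨R, hR⟩ := ((isCompact_Icc.image_of_continuousOn hxc).union
    (isCompact_Icc.image_of_continuousOn hyc)).isBounded.subset_closedBall 0
  obtain ⟨K, hK⟩ := exists_lipschitzOnWith_closedBall hF T 0 R
  exact ODE_solution_unique_of_mem_Icc_right (v := F) (s := fun _ => Metric.closedBall 0 R)
    (fun t ht => hK t (Set.Ico_subset_Icc_self ht)) hxc
    (fun t ht => hasDerivWithinAt_Ici_of_Icc ht (hx t (Set.Ico_subset_Icc_self ht)))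
    (fun t ht => hR (Or.inl ⟨t, Set.Ico_subset_Icc_self ht, rfl⟩)) hyc
    (fun t ht => hasDerivWithinAt_Ici_of_Icc ht (hy t (Set.Ico_subset_Icc_self ht)))
    (fun t ht => hR (Or.inr ⟨t, Set.Ico_subset_Icc_self ht, rfl⟩)) h0

/-- A bounded `C¹` vector field has solutions on all of `[0, T]`: in a ball of radius `L T` the
Picard–Lindelöf theorem imposes no restriction on the length of the time interval. -/
theorem ode_exists_of_bounded {F : ℝ → E → E} (hF : ContDiff ℝ 1 (Function.uncurry F)) {T : ℝ}
    (hT : 0 ≤ T) {L : ℝ≥0} (hL : ∀ t x, ‖F t x‖ ≤ L) (x₀ : E) :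
    ∃ x : ℝ → E, x 0 = x₀ ∧
      ∀ t ∈ Set.Icc 0 T, HasDerivWithinAt x (F t (x t)) (Set.Icc 0 T) t := by
  have := FiniteDimensional.complete ℝ E
  obtain ⟨K, hK⟩ := exists_lipschitzOnWith_closedBall hF T x₀ (L * T.toNNReal : ℝ≥0)
  have hP : IsPicardLindelof F (tmin := 0) (tmax := T) ⟨0, le_rfl, hT⟩ x₀ (L * T.toNNReal) 0
      L K :=
    { lipschitzOnWith := hK
      continuousOn := fun x _ => by
        have : Continuous fun t => F t x :=
          hF.continuous.comp (by fun_prop : Continuous fun t => (t, x))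
        exact this.continuousOn
      norm_le := fun t _ x _ => hL t x
      mul_max_le := by
        simp only [sub_zero, sub_self, max_eq_left hT, NNReal.coe_zero, NNReal.coe_mul,
          Real.coe_toNNReal T hT, le_refl] }
  exact hP.exists_eq_forall_mem_Icc_hasDerivWithinAt₀

end ODE

/-! ### The Galerkin system as an ordinary differential equation -/

/-- Extension by zero of a family indexed by the modes of modulus at most `m`. -/
noncomputable def extendModes (m : ℕ) (x : modes m → ℂ) (k : ℤ) : ℂ :=
  if h : k ∈ modes m then x ⟨k, h⟩ else 0

/-- The Galerkin vector field on the finite-dimensional space of modes. -/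
noncomputable def odeField (m : ℕ) (t : ℝ) (x : modes m → ℂ) (k : modes m) : ℂ :=
  field m t (extendModes m x) k

theorem extendModes_coe {m : ℕ} (x : modes m → ℂ) (k : modes m) : extendModes m x k = x k := by
  simp [extendModes]

theorem field_congr {m : ℕ} {t : ℝ} {u v : ℤ → ℂ} (h : ∀ k ∈ modes m, u k = v k) (k : ℤ) :
    field m t u k = field m t v k := by
  unfold field
  congr 1
  refine Finset.sum_congr rfl fun a ha => Finset.sum_congr rfl fun b hb => ?_
  rw [h a ha, h b hb]

theorem contDiff_extendModes (m : ℕ) (k : ℤ) :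
    ContDiff ℝ 1 (fun x : modes m → ℂ => extendModes m x k) := by
  unfold extendModes
  split_ifs
  · exact contDiff_apply ℝ ℂ _
  · exact contDiff_const

theorem contDiff_odeField (m : ℕ) :
    ContDiff ℝ 1 (fun z : ℝ × (modes m → ℂ) => odeField m z.1 z.2) := by
  rw [contDiff_pi]
  intro k
  unfold odeField field
  refine contDiff_const.mul (ContDiff.sum fun a _ => ContDiff.sum fun b _ => ?_)
  split_ifs
  · have h1 := (contDiff_extendModes m a).comp (contDiff_snd (𝕜 := ℝ) (E := ℝ) (F := modes m → ℂ))
    have h2 := (contDiff_extendModes m b).comp (contDiff_snd (𝕜 := ℝ) (E := ℝ) (F := modes m → ℂ))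
    have h3 : ContDiff ℝ 1 (fun z : ℝ × (modes m → ℂ) => (z.1 : ℂ)) :=
      Complex.ofRealCLM.contDiff.comp contDiff_fst
    exact ((contDiff_const.mul h3).cexp.mul h1).mul h2
  · exact contDiff_const

/-- The involution `x_k ↦ conj x_{-k}`, whose fixed points are the real sequences. -/
noncomputable def reflect (m : ℕ) (x : modes m → ℂ) (k : modes m) : ℂ :=
  conj (x ⟨-k.1, neg_mem_modes.2 k.2⟩)

theorem extendModes_reflect (m : ℕ) (x : modes m → ℂ) (k : ℤ) :
    extendModes m (reflect m x) k = conj (extendModes m x (-k)) := by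
  unfold extendModes reflect
  by_cases h : k ∈ modes m
  · rw [dif_pos h, dif_pos (neg_mem_modes.2 h)]
  · rw [dif_neg h, dif_neg (fun h' => h (neg_mem_modes.1 h')), map_zero]

theorem odeField_reflect (m : ℕ) (t : ℝ) (x : modes m → ℂ) :
    odeField m t (reflect m x) = reflect m (odeField m t x) := by
  funext k
  unfold odeField
  rw [reflect]
  unfold field
  simp only [map_mul, map_sum, map_div₀, map_one, Complex.conj_I, map_ofNat, map_intCast]
  rw [← sum_modes_neg]
  have hs : ∀ a : ℤ, (∑ b ∈ modes m, if -a + b = k.1 then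
        Complex.exp (Complex.I * 3 * ((k.1 : ℤ) : ℂ) * ((-a : ℤ) : ℂ) * (b : ℂ) * (t : ℂ)) *
          extendModes m (reflect m x) (-a) * extendModes m (reflect m x) b else 0) =
      ∑ b ∈ modes m, conj (if a + b = -k.1 then
        Complex.exp (Complex.I * 3 * ((-k.1 : ℤ) : ℂ) * (a : ℂ) * (b : ℂ) * (t : ℂ)) *
          extendModes m x a * extendModes m x b else 0) := by
    intro a
    rw [← sum_modes_neg]
    refine Finset.sum_congr rfl fun b _ => ?_
    have hiff : -a + -b = k.1 ↔ a + b = -k.1 := by constructor <;> intro h <;> linarith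
    simp only [hiff]
    split_ifs
    · rw [extendModes_reflect, extendModes_reflect, neg_neg, neg_neg, map_mul, map_mul,
        ← Complex.exp_conj]
      congr 3
      simp only [map_mul, Complex.conj_I, map_ofNat, map_intCast, Complex.conj_ofReal]
      push_cast; ring
    · simp
  simp_rw [hs]
  push_cast
  ring

/-- Solutions issued from real data stay real, for the Galerkin vector field multiplied by a scalar
factor that is invariant under `reflect`. -/
theorem reflect_eq_of_solution {m : ℕ} {T : ℝ} {θ : (modes m → ℂ) → ℝ} (hθ : ContDiff ℝ 1 θ)
    (hθr : ∀ x, θ (reflect m x) = θ x) {x : ℝ → modes m → ℂ}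
    (hx : ∀ t ∈ Set.Icc 0 T, HasDerivWithinAt x (θ (x t) • odeField m t (x t)) (Set.Icc 0 T) t)
    (h0 : reflect m (x 0) = x 0) : ∀ t ∈ Set.Icc 0 T, reflect m (x t) = x t := by
  have hF : ContDiff ℝ 1 (Function.uncurry fun (t : ℝ) (x : modes m → ℂ) =>
      θ x • odeField m t x) :=
    (hθ.comp contDiff_snd).smul (contDiff_odeField m)
  refine ode_unique hF (fun t ht => ?_) hx h0
  rw [hasDerivWithinAt_pi]
  intro k
  have h := (hasDerivWithinAt_pi.1 (hx t ht) ⟨-k.1, neg_mem_modes.2 k.2⟩).star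
  refine h.congr_deriv ?_
  rw [hθr, odeField_reflect]
  simp [reflect]

theorem sum_modes_extendModes {m : ℕ} (x : modes m → ℂ) :
    ∑ k ∈ modes m, ‖extendModes m x k‖ ^ 2 = ∑ k : modes m, ‖x k‖ ^ 2 := by
  rw [← Finset.sum_coe_sort]
  simp_rw [extendModes_coe]

theorem norm_odeField_le (m : ℕ) (t : ℝ) (x : modes m → ℂ) :
    ‖odeField m t x‖ ≤ m * ∑ k : modes m, ‖x k‖ ^ 2 := by
  have hS : 0 ≤ ∑ k : modes m, ‖x k‖ ^ 2 := Finset.sum_nonneg fun _ _ => by positivity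
  rw [pi_norm_le_iff_of_nonneg (by positivity)]
  intro k
  refine (norm_field_le m t _ _).trans ?_
  have h1 := modeConv_le m (fun k => ‖extendModes m x k‖) (fun k => ‖extendModes m x k‖) k
  rw [sum_modes_extendModes, Real.mul_self_sqrt hS] at h1
  have h2 : |((k : ℤ) : ℝ)| ≤ m := by
    rw [← Int.cast_abs]; exact_mod_cast (mem_modes.1 k.2).2
  have h3 := modeConv_nonneg m (fun k => norm_nonneg (extendModes m x k))
    (fun k => norm_nonneg (extendModes m x k)) k
  calc _ ≤ 1 * (m : ℝ) * ∑ k : modes m, ‖x k‖ ^ 2 := by gcongr; norm_num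
    _ = _ := by rw [one_mul]

/-- Global existence for the Galerkin system. Dividing the vector field by `1 + ∑ |x_k|²` makes it
bounded without affecting conservation of `∑ |x_k|²`, so the factor is constant along the solution
and can be normalized to `1`. -/
theorem exists_odeField_solution (m : ℕ) {T : ℝ} (hT : 0 ≤ T) (x₀ : modes m → ℂ)
    (h0 : reflect m x₀ = x₀) :
    ∃ x : ℝ → modes m → ℂ, x 0 = x₀ ∧
      ∀ t ∈ Set.Icc 0 T, HasDerivWithinAt x (odeField m t (x t)) (Set.Icc 0 T) t := by
  obtain ⟨S, hS⟩ : ∃ S : (modes m → ℂ) → ℝ, ∀ x, S x = ∑ k : modes m, ‖x k‖ ^ 2 :=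
    ⟨_, fun _ => rfl⟩
  have hS0 : ∀ x, 0 ≤ S x := fun x => by rw [hS]; exact Finset.sum_nonneg fun _ _ => by positivity
  have hSc : ContDiff ℝ 1 S := by
    rw [funext hS]
    exact ContDiff.sum fun k _ => (contDiff_apply ℝ ℂ k).norm_sq ℝ
  have hSr : ∀ x, S (reflect m x) = S x := fun x => by
    rw [hS, hS]
    refine Fintype.sum_equiv ⟨fun k => ⟨-k.1, neg_mem_modes.2 k.2⟩,
      fun k => ⟨-k.1, neg_mem_modes.2 k.2⟩, fun k => by simp, fun k => by simp⟩ _ _ fun k => ?_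
    simp [reflect]
  set θ : (modes m → ℂ) → ℝ := fun x => (1 + S x₀) / (1 + S x) with hθ
  have hθc : ContDiff ℝ 1 θ :=
    contDiff_const.div (contDiff_const.add hSc) fun x => by have := hS0 x; positivity
  have hθr : ∀ x, θ (reflect m x) = θ x := fun x => by simp only [hθ, hSr]
  have hF : ContDiff ℝ 1 (Function.uncurry fun (t : ℝ) (x : modes m → ℂ) =>
      θ x • odeField m t x) :=
    (hθc.comp contDiff_snd).smul (contDiff_odeField m)
  have hb : ∀ t x, ‖θ x • odeField m t x‖ ≤ ((Real.toNNReal ((1 + S x₀) * m) : ℝ≥0) : ℝ) := by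
    intro t x
    have h1 := norm_odeField_le m t x
    rw [← hS] at h1
    have h2 := hS0 x
    have h3 := hS0 x₀
    rw [Real.coe_toNNReal _ (by positivity), norm_smul, Real.norm_of_nonneg (by positivity)]
    calc θ x * ‖odeField m t x‖ ≤ θ x * (m * (1 + S x)) := by
          gcongr
          exact h1.trans (by gcongr; linarith)
      _ = _ := by simp only [hθ]; field_simp
  obtain ⟨x, hx0, hx⟩ := ode_exists_of_bounded hF hT hb x₀
  refine ⟨x, hx0, fun t ht => ?_⟩
  have hreal := reflect_eq_of_solution hθc hθr hx (by rw [hx0, h0])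
  have hcons := sum_norm_sq_eq (m := m) (T := T) (u := fun t => extendModes m (x t))
    (θ := fun t => (θ (x t) : ℂ)) (fun k hk t ht => by
      have h := hasDerivWithinAt_pi.1 (hx t ht) ⟨k, hk⟩
      simpa [extendModes, hk, odeField] using h) (fun t ht k hk => by
      have h := extendModes_reflect m (x t) (-k)
      rw [hreal t ht, neg_neg] at h
      exact h) t ht
  rw [sum_modes_extendModes, sum_modes_extendModes, ← hS, ← hS, hx0] at hcons
  have hθ1 : θ (x t) = 1 := by
    simp only [hθ]; rw [hcons]
    have := hS0 x₀
    exact div_self (by positivity)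
  simpa [hθ1] using hx t ht

/-! ### From sequences on the nonzero integers to finite sums -/

/-- Extension to all integers, by zero at `0`, of a sequence indexed by the nonzero integers. -/
noncomputable def extendZero (a : Z0 → ℂ) (k : ℤ) : ℂ := if h : k ≠ 0 then a ⟨k, h⟩ else 0

theorem extendZero_coe (a : Z0 → ℂ) (k : Z0) : extendZero a k.1 = a k := by
  simp [extendZero, k.2]

theorem coe_mem_modes {m : ℕ} {k : Z0} : k.1 ∈ modes m ↔ |k.1| ≤ (m : ℤ) := by
  simp [mem_modes, k.2]

/-- The right-hand side of the Galerkin system as a finite sum. -/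
theorem galerkin_rhs_eq {m : ℕ} (t : ℝ) (a : Z0 → ℂ) {k : Z0} (hk : k.1 ∈ modes m) :
    1 / 2 * Complex.I * (k.1 : ℂ) * trunc m (oscConv t (trunc m a) (trunc m a)) k =
      field m t (extendZero a) k.1 := by
  have hk' := coe_mem_modes.1 hk
  rw [trunc, if_pos hk', field]
  congr 1
  set G : ℤ × ℤ → ℂ := fun p => if p.1 ∈ modes m ∧ p.2 ∈ modes m then
    (if p.1 + p.2 = k.1 then Complex.exp (Complex.I * 3 * (k.1 : ℂ) * (p.1 : ℂ) * (p.2 : ℂ) *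
      (t : ℂ)) * extendZero a p.1 * extendZero a p.2 else 0) else 0 with hG
  have hι : Function.Injective
      (fun p : {p : Z0 × Z0 // p.1.1 + p.2.1 = k.1} => ((p.1.1.1, p.1.2.1) : ℤ × ℤ)) := by
    rintro ⟨⟨⟨a, _⟩, ⟨b, _⟩⟩, _⟩ ⟨⟨⟨c, _⟩, ⟨d, _⟩⟩, _⟩ h
    simpa using h
  have h1 : oscConv t (trunc m a) (trunc m a) k = ∑' p, G p := by
    rw [oscConv, ← hι.tsum_eq (f := G)]
    · refine tsum_congr fun p => ?_
      simp only [hG, trunc, coe_mem_modes, extendZero_coe, p.2, if_true]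
      by_cases hx : |p.1.1.1| ≤ (m : ℤ) <;> by_cases hy : |p.1.2.1| ≤ (m : ℤ) <;> simp [hx, hy]
    · intro p hp
      simp only [hG, Function.mem_support, ne_eq, ite_eq_right_iff, not_forall] at hp
      obtain ⟨⟨hx, hy⟩, hxy, -⟩ := hp
      exact ⟨⟨⟨⟨p.1, (mem_modes.1 hx).1⟩, ⟨p.2, (mem_modes.1 hy).1⟩⟩, hxy⟩, rfl⟩
  rw [h1, tsum_eq_sum (s := modes m ×ˢ modes m), Finset.sum_product]
  · refine Finset.sum_congr rfl fun x hx => Finset.sum_congr rfl fun y hy => ?_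
    simp only [hG, hx, hy, and_self, if_true]
  · intro p hp
    rw [Finset.mem_product] at hp
    simp only [hG, if_neg hp]

/-! ### Sobolev norms split at a frequency -/

/-- The square `∑ |k|^{2s} |a_k|²` of the Sobolev norm. -/
noncomputable def hSum (s : ℝ) (a : Z0 → ℂ) : ℝ≥0∞ :=
  ∑' k : Z0, ENNReal.ofReal (|(k.1 : ℝ)| ^ (2 * s) * ‖a k‖ ^ 2)

theorem hNorm_eq (s : ℝ) (a : Z0 → ℂ) : hNorm s a = hSum s a ^ (1 / 2 : ℝ) := rfl

theorem hNorm_sq (s : ℝ) (a : Z0 → ℂ) : hNorm s a ^ 2 = hSum s a := by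
  rw [hNorm_eq, ← ENNReal.rpow_natCast, ← ENNReal.rpow_mul]
  norm_num

theorem hNorm_le_iff {s : ℝ} {a : Z0 → ℂ} {c : ℝ≥0∞} : hNorm s a ≤ c ↔ hSum s a ≤ c ^ 2 := by
  rw [← hNorm_sq]
  exact (ENNReal.pow_le_pow_left_iff two_ne_zero).symm

theorem one_le_abs_coe (k : Z0) : (1 : ℝ) ≤ |(k.1 : ℝ)| := by
  rw [← Int.cast_abs]; exact_mod_cast Int.one_le_abs k.2

/-- The contribution of the frequencies of modulus larger than `m`. -/
noncomputable def hTail (s : ℝ) (m : ℕ) (a : Z0 → ℂ) : ℝ≥0∞ :=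
  ∑' k : Z0, if |k.1| ≤ (m : ℤ) then 0 else ENNReal.ofReal (|(k.1 : ℝ)| ^ (2 * s) * ‖a k‖ ^ 2)

theorem hSum_eq (s : ℝ) (m : ℕ) (a : Z0 → ℂ) :
    hSum s a = ENNReal.ofReal (modeEnergy s m fun k => ‖extendZero a k‖) + hTail s m a := by
  set G : ℤ → ℝ≥0∞ := fun k => if k ∈ modes m then
    ENNReal.ofReal (|(k : ℝ)| ^ (2 * s) * ‖extendZero a k‖ ^ 2) else 0 with hG
  have h1 : ∑' k : Z0, G k.1 = ENNReal.ofReal (modeEnergy s m fun k => ‖extendZero a k‖) := by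
    rw [Subtype.val_injective.tsum_eq (f := G), tsum_eq_sum (s := modes m), modeEnergy,
      ENNReal.ofReal_sum_of_nonneg fun _ _ => by positivity]
    · exact Finset.sum_congr rfl fun k hk => by simp only [hG, if_pos hk]
    · intro k hk; simp only [hG, if_neg hk]
    · intro k hk
      simp only [hG, Function.mem_support, ne_eq, ite_eq_right_iff, not_forall] at hk
      exact ⟨⟨k, (mem_modes.1 hk.1).1⟩, rfl⟩
  rw [hSum, hTail, ← h1, ← ENNReal.tsum_add]
  refine tsum_congr fun k => ?_
  simp only [hG, coe_mem_modes, extendZero_coe]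
  split_ifs <;> simp

theorem modeEnergy_le_of_hSum_le {s C : ℝ} (hC : 0 ≤ C) {a : Z0 → ℂ}
    (h : hSum s a ≤ ENNReal.ofReal C) (m : ℕ) :
    modeEnergy s m (fun k => ‖extendZero a k‖) ≤ C := by
  rw [hSum_eq s m a] at h
  exact (ENNReal.ofReal_le_ofReal_iff hC).1 (le_self_add.trans h)

theorem hTail_le (s : ℝ) (m : ℕ) (a : Z0 → ℂ) : hTail s m a ≤ hSum s a := by
  rw [hSum_eq s m a]; exact le_add_self

/-! ### Properties of Galerkin solutions -/

section Galerkin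

variable {m : ℕ} {T : ℝ} {v0 : Z0 → ℂ} {v : ℝ → Z0 → ℂ}

theorem extendModes_restrict (a : Z0 → ℂ) {k : ℤ} (hk : k ∈ modes m) :
    extendModes m (fun j : modes m => extendZero a j) k = extendZero a k := by
  simp [extendModes, hk]

theorem reflect_restrict {a : Z0 → ℂ} (ha : IsRealSeq a) :
    reflect m (fun j : modes m => extendZero a j) = fun j : modes m => extendZero a j := by
  funext k
  have hk := (mem_modes.1 k.2).1
  have h := ha (neg ⟨k, hk⟩)
  have e : neg (neg ⟨k, hk⟩) = ⟨(k : ℤ), hk⟩ := by simp [neg]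
  rw [e] at h
  simp only [reflect, extendZero, neg_ne_zero, ne_eq, hk, not_false_eq_true, dif_pos]
  rw [h]; rfl

theorem exists_isGalerkinSolution (m : ℕ) (hT : 0 ≤ T) (hv0 : IsRealSeq v0) :
    ∃ v, IsGalerkinSolution m T v0 v := by
  obtain ⟨x, hx0, hx⟩ := exists_odeField_solution m hT (fun j : modes m => extendZero v0 j)
    (reflect_restrict hv0)
  set v : ℝ → Z0 → ℂ := fun t k => if k.1 ∈ modes m then extendModes m (x t) k.1 else v0 k with hv
  refine ⟨v, ?_, fun k t ht => ?_⟩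
  · funext k
    simp only [hv]
    split_ifs with hk
    · rw [hx0, extendModes_restrict v0 hk, extendZero_coe]
    · rfl
  · by_cases hk : k.1 ∈ modes m
    · rw [galerkin_rhs_eq t (v t) hk]
      have h := hasDerivWithinAt_pi.1 (hx t ht) ⟨k.1, hk⟩
      have e1 : (fun τ => v τ k) = fun τ => x τ ⟨k.1, hk⟩ := by
        funext τ; simp [hv, hk, extendModes]
      rw [e1]
      refine h.congr_deriv ?_
      refine field_congr (fun j hj => ?_) _
      have hj0 := (mem_modes.1 hj).1
      simp [extendZero, hj0, hv, hj]
    · have e1 : (fun τ => v τ k) = fun _ => v0 k := by funext τ; simp [hv, hk]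
      rw [e1, trunc, if_neg (fun h => hk (coe_mem_modes.2 h)), mul_zero]
      exact hasDerivWithinAt_const _ _ _

theorem IsGalerkinSolution.hasDerivWithinAt (h : IsGalerkinSolution m T v0 v) {k : ℤ}
    (hk : k ∈ modes m) {t : ℝ} (ht : t ∈ Set.Icc 0 T) :
    HasDerivWithinAt (fun τ => extendZero (v τ) k) (field m t (extendZero (v t)) k)
      (Set.Icc 0 T) t := by
  have hk0 := (mem_modes.1 hk).1
  have h1 := h.2 ⟨k, hk0⟩ t ht
  rw [galerkin_rhs_eq t (v t) hk] at h1
  simpa [extendZero, hk0] using h1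

theorem IsGalerkinSolution.apply_of_notMem (h : IsGalerkinSolution m T v0 v) {k : Z0}
    (hk : k.1 ∉ modes m) {t : ℝ} (ht : t ∈ Set.Icc 0 T) : v t k = v0 k := by
  have hd : ∀ t ∈ Set.Icc 0 T, HasDerivWithinAt (fun τ => v τ k) 0 (Set.Icc 0 T) t :=
    fun t ht => by
      have := h.2 k t ht
      rwa [trunc, if_neg (fun h => hk (coe_mem_modes.2 h)), mul_zero] at this
  rw [constant_of_has_deriv_right_zero (fun t ht => (hd t ht).continuousWithinAt)
    (fun t ht => hasDerivWithinAt_Ici_of_Icc ht (hd t (Set.Ico_subset_Icc_self ht))) t ht, h.1]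

theorem IsGalerkinSolution.extendZero_neg (h : IsGalerkinSolution m T v0 v) (hv0 : IsRealSeq v0) :
    ∀ t ∈ Set.Icc 0 T, ∀ k ∈ modes m, extendZero (v t) (-k) = conj (extendZero (v t) k) := by
  intro t ht k hk
  have hx : ∀ t ∈ Set.Icc 0 T, HasDerivWithinAt (fun t (j : modes m) => extendZero (v t) j)
      ((1 : ℝ) • odeField m t (fun j : modes m => extendZero (v t) j)) (Set.Icc 0 T) t := by
    intro t ht
    rw [one_smul, hasDerivWithinAt_pi]
    intro j
    refine (h.hasDerivWithinAt j.2 ht).congr_deriv ?_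
    exact field_congr (fun i hi => (extendModes_restrict (v t) hi).symm) _
  have hr := reflect_eq_of_solution (θ := fun _ => 1) contDiff_const (fun _ => rfl) hx
    (by rw [h.1]; exact reflect_restrict hv0) t ht
  have := congrFun hr ⟨-k, neg_mem_modes.2 hk⟩
  simp only [reflect, neg_neg] at this
  exact this.symm

theorem IsGalerkinSolution.isRealSeq (h : IsGalerkinSolution m T v0 v) (hv0 : IsRealSeq v0)
    {t : ℝ} (ht : t ∈ Set.Icc 0 T) : IsRealSeq (v t) := by
  intro k
  by_cases hk : k.1 ∈ modes m
  · have := h.extendZero_neg hv0 t ht k.1 hk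
    rwa [extendZero_coe, show -k.1 = (neg k).1 from rfl, extendZero_coe] at this
  · rw [h.apply_of_notMem hk ht, h.apply_of_notMem (k := neg k) (fun h' => hk
      (neg_mem_modes.1 h')) ht]
    exact hv0 k

theorem IsGalerkinSolution.hTail_eq (h : IsGalerkinSolution m T v0 v) (s : ℝ) {t : ℝ}
    (ht : t ∈ Set.Icc 0 T) : hTail s m (v t) = hTail s m v0 := by
  refine tsum_congr fun k => ?_
  split_ifs with hk
  · rfl
  · rw [h.apply_of_notMem (fun h' => hk (coe_mem_modes.1 h')) ht]

theorem IsGalerkinSolution.hSum_zero_eq (h : IsGalerkinSolution m T v0 v) (hv0 : IsRealSeq v0)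
    {t : ℝ} (ht : t ∈ Set.Icc 0 T) : hSum 0 (v t) = hSum 0 v0 := by
  have h1 := sum_norm_sq_eq (u := fun t => extendZero (v t)) (θ := fun _ => 1)
    (fun k hk t ht => by simpa using h.hasDerivWithinAt hk ht) (h.extendZero_neg hv0) t ht
  rw [hSum_eq 0 m (v t), hSum_eq 0 m v0, h.hTail_eq 0 ht, modeEnergy_zero, modeEnergy_zero, h1, h.1]

/-- The uniform `Ḣ^s` bound for Galerkin solutions. -/
theorem exists_galerkin_hNorm_le {s : ℝ} (hs : 0 < s) (T : ℝ) (M₀ N : ℝ≥0) :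
    ∃ M : ℝ≥0, ∀ v0 : Z0 → ℂ, IsRealSeq v0 → hNorm 0 v0 ≤ M₀ → hNorm s v0 ≤ N →
      ∀ (m : ℕ) (v : ℝ → Z0 → ℂ), IsGalerkinSolution m T v0 v →
        ∀ t ∈ Set.Icc (0 : ℝ) T, hNorm s (v t) ≤ M := by
  obtain ⟨C, hC0, hC⟩ := exists_modeEnergy_le hs M₀.coe_nonneg T ((N : ℝ) ^ 2)
  -- `C` bounds the moving modes, `N ^ 2` the frozen ones beyond the truncation
  refine ⟨NNReal.sqrt (Real.toNNReal C + N ^ 2), fun v0 hv0 h0 hN m v hv t ht => ?_⟩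
  have hcoe : ∀ x : ℝ≥0, ((x : ℝ≥0∞)) ^ 2 = ENNReal.ofReal ((x : ℝ) ^ 2) := fun x => by
    rw [← NNReal.coe_pow, ENNReal.ofReal_coe_nnreal]; push_cast; rfl
  rw [hNorm_le_iff] at h0 hN ⊢
  have hE := hC m (fun t => extendZero (v t)) (fun k hk t ht => hv.hasDerivWithinAt hk ht)
    (hv.extendZero_neg hv0) (by
      rw [← modeEnergy_zero, hv.1]
      exact modeEnergy_le_of_hSum_le (by positivity) (hcoe M₀ ▸ h0) m) (by
      rw [hv.1]
      exact modeEnergy_le_of_hSum_le (by positivity) (hcoe N ▸ hN) m) t ht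
  rw [hSum_eq s m, hv.hTail_eq s ht]
  calc _ ≤ ENNReal.ofReal C + (N : ℝ≥0∞) ^ 2 :=
        add_le_add (ENNReal.ofReal_le_ofReal hE) ((hTail_le s m v0).trans hN)
    _ = ((NNReal.sqrt (Real.toNNReal C + N ^ 2) ^ 2 : ℝ≥0) : ℝ≥0∞) := by
        rw [NNReal.sq_sqrt]; push_cast; rfl
    _ = _ := by push_cast; rfl

theorem IsGalerkinSolution.continuousOn (h : IsGalerkinSolution m T v0 v) (k : Z0) :
    ContinuousOn (fun t => v t k) (Set.Icc 0 T) := fun t ht => (h.2 k t ht).continuousWithinAt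

theorem IsGalerkinSolution.continuousOn_field (h : IsGalerkinSolution m T v0 v) (k : ℤ) :
    ContinuousOn (fun t => field m t (extendZero (v t)) k) (Set.Icc 0 T) := by
  unfold field
  have hc : ∀ j : ℤ, ContinuousOn (fun t => extendZero (v t) j) (Set.Icc 0 T) := fun j => by
    unfold extendZero
    split_ifs with hj
    · exact h.continuousOn ⟨j, hj⟩
    · exact continuousOn_const
  refine continuousOn_const.mul (continuousOn_finsetSum _ fun a _ =>
    continuousOn_finsetSum _ fun b _ => ?_)
  split_ifs
  · refine ContinuousOn.mul (ContinuousOn.mul ?_ (hc a)) (hc b)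
    exact Continuous.continuousOn (by fun_prop)
  · exact continuousOn_const

/-- The vector field at a fixed frequency is controlled by the conserved `ℓ²` norm. -/
theorem IsGalerkinSolution.norm_field_le (h : IsGalerkinSolution m T v0 v) (hv0 : IsRealSeq v0)
    {B : ℝ≥0} (hB : hNorm 0 v0 ≤ B) (k : ℤ) {t : ℝ} (ht : t ∈ Set.Icc 0 T) :
    ‖field m t (extendZero (v t)) k‖ ≤ 1 / 2 * |(k : ℝ)| * (B : ℝ) ^ 2 := by
  refine (PeriodicKdV.norm_field_le m t _ k).trans ?_
  gcongr
  refine (modeConv_le m _ _ k).trans ?_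
  rw [hNorm_le_iff, ← h.hSum_zero_eq hv0 ht] at hB
  have hcoe : ((B : ℝ≥0∞)) ^ 2 = ENNReal.ofReal ((B : ℝ) ^ 2) := by
    rw [← NNReal.coe_pow, ENNReal.ofReal_coe_nnreal]; push_cast; rfl
  have h1 := modeEnergy_le_of_hSum_le (by positivity) (hcoe ▸ hB) m
  rw [modeEnergy_zero] at h1
  rw [Real.mul_self_sqrt (Finset.sum_nonneg fun _ _ => by positivity)]
  exact h1

theorem IsGalerkinSolution.norm_sub_le (h : IsGalerkinSolution m T v0 v) (hv0 : IsRealSeq v0)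
    {B : ℝ≥0} (hB : hNorm 0 v0 ≤ B) (k : Z0) {t t' : ℝ} (ht : t ∈ Set.Icc 0 T)
    (ht' : t' ∈ Set.Icc 0 T) : ‖v t k - v t' k‖ ≤ 1 / 2 * |(k.1 : ℝ)| * (B : ℝ) ^ 2 * |t - t'| := by
  by_cases hk : k.1 ∈ modes m
  · have := (convex_Icc 0 T).norm_image_sub_le_of_norm_hasDerivWithin_le
      (f := fun τ => v τ k) (f' := fun τ => field m τ (extendZero (v τ)) k.1)
      (fun τ hτ => by rw [← galerkin_rhs_eq τ (v τ) hk]; exact h.2 k τ hτ)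
      (fun τ hτ => h.norm_field_le hv0 hB k.1 hτ) ht' ht
    simpa using this
  · rw [h.apply_of_notMem hk ht, h.apply_of_notMem hk ht', sub_self, norm_zero]
    positivity

theorem IsGalerkinSolution.sub_eq_integral (h : IsGalerkinSolution m T v0 v) {k : Z0}
    (hk : k.1 ∈ modes m) {t : ℝ} (ht : t ∈ Set.Icc 0 T) :
    v t k - v 0 k = ∫ τ in (0 : ℝ)..t, field m τ (extendZero (v τ)) k.1 := by
  have hsub : Set.Icc 0 t ⊆ Set.Icc 0 T := Set.Icc_subset_Icc_right ht.2
  refine (intervalIntegral.integral_eq_sub_of_hasDeriv_right_of_le ht.1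
    ((h.continuousOn k).mono hsub) (fun τ hτ => ?_) ?_).symm
  · have hτ' : τ ∈ Set.Ico 0 T := ⟨hτ.1.le, hτ.2.trans_le ht.2⟩
    have := h.2 k τ (Set.Ico_subset_Icc_self hτ')
    rw [galerkin_rhs_eq τ (v τ) hk] at this
    exact (hasDerivWithinAt_Ici_of_Icc hτ' this).mono Set.Ioi_subset_Ici_self
  · refine ContinuousOn.intervalIntegrable ?_
    rw [Set.uIcc_of_le ht.1]
    exact (h.continuousOn_field k.1).mono hsub

theorem norm_le_of_hNorm_zero_le {a : Z0 → ℂ} {B : ℝ≥0} (hB : hNorm 0 a ≤ B) (k : Z0) :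
    ‖a k‖ ≤ B := by
  rw [hNorm_le_iff] at hB
  have h1 := (ENNReal.le_tsum k).trans hB
  simp only [mul_zero, Real.rpow_zero, one_mul] at h1
  rw [show ((B : ℝ≥0∞)) ^ 2 = ENNReal.ofReal ((B : ℝ) ^ 2) by
    rw [← NNReal.coe_pow, ENNReal.ofReal_coe_nnreal]; push_cast; rfl,
    ENNReal.ofReal_le_ofReal_iff (by positivity)] at h1
  exact abs_le_of_sq_le_sq' h1 B.coe_nonneg |>.2

end Galerkin

/-! ### Compactness in the scale of Sobolev norms -/

/-- Convergence of sums of nonnegative terms under termwise convergence and uniformly small tails. -/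
theorem tendsto_tsum_of_uniform_tail {ι : Type*} {x : ℕ → ι → ℝ≥0∞} {y : ι → ℝ≥0∞}
    (hxy : ∀ i, Tendsto (fun n => x n i) atTop (𝓝 (y i)))
    (htail : ∀ ε : ℝ≥0, 0 < ε → ∃ F : Finset ι, ∀ n,
      ∑' i : ((F : Set ι)ᶜ : Set ι), x n i ≤ ε) :
    Tendsto (fun n => ∑' i, x n i) atTop (𝓝 (∑' i, y i)) := by
  have hF : ∀ F : Finset ι, Tendsto (fun n => ∑ i ∈ F, x n i) atTop (𝓝 (∑ i ∈ F, y i)) :=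
    fun F => tendsto_finsetSum F fun i _ => hxy i
  refine tendsto_order.2 ⟨fun a ha => ?_, fun b hb => ?_⟩
  · rw [ENNReal.tsum_eq_iSup_sum] at ha
    obtain ⟨F, hFa⟩ := lt_iSup_iff.1 ha
    filter_upwards [(hF F).eventually_const_lt hFa] with n hn
    exact hn.trans_le (ENNReal.sum_le_tsum F)
  · obtain ⟨r, hr, hrb⟩ := ENNReal.lt_iff_exists_add_pos_lt.1 hb
    obtain ⟨F, hFr⟩ := htail r hr
    have h1 : Tendsto (fun n => ∑ i ∈ F, x n i + r) atTop (𝓝 (∑ i ∈ F, y i + r)) :=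
      (hF F).add tendsto_const_nhds
    have h2 : ∑ i ∈ F, y i + r < b :=
      (add_le_add (ENNReal.sum_le_tsum F) le_rfl).trans_lt hrb
    filter_upwards [h1.eventually_lt_const h2] with n hn
    rw [← ENNReal.sum_add_tsum_compl F]
    exact (add_le_add le_rfl (hFr n)).trans_lt hn

/-- A bound in `Ḣ^s` makes the tails of the `Ḣ^σ` norm uniformly small, for `σ < s`. -/
theorem exists_tail_le {σ s : ℝ} (hσ : σ < s) {B : ℝ≥0∞} (hB : B ≠ ∞) {ε : ℝ≥0} (hε : 0 < ε) :
    ∃ F : Finset Z0, ∀ a : Z0 → ℂ, hSum s a ≤ B →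
      ∑' k : ((F : Set Z0)ᶜ : Set Z0),
        ENNReal.ofReal (|(k.1.1 : ℝ)| ^ (2 * σ) * ‖a k.1‖ ^ 2) ≤ ε := by
  have hlim : Tendsto (fun n : ℕ => ENNReal.ofReal ((n : ℝ) ^ (-(2 * (s - σ)))) * B) atTop
      (𝓝 (ENNReal.ofReal 0 * B)) := by
    refine ENNReal.Tendsto.mul_const (ENNReal.tendsto_ofReal ?_) (Or.inr hB)
    exact (tendsto_rpow_neg_atTop (by linarith)).comp tendsto_natCast_atTop_atTop
  rw [ENNReal.ofReal_zero, zero_mul] at hlim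
  obtain ⟨n, hn, hn1⟩ := ((hlim.eventually_le_const (ENNReal.coe_pos.2 hε)).and
    (eventually_ge_atTop 1)).exists
  refine ⟨(modes n).subtype (fun k => k ≠ 0), fun a ha => ?_⟩
  calc ∑' k : ((((modes n).subtype (fun k => k ≠ 0) : Finset Z0) : Set Z0)ᶜ : Set Z0),
        ENNReal.ofReal (|(k.1.1 : ℝ)| ^ (2 * σ) * ‖a k.1‖ ^ 2)
      ≤ ∑' k : ((((modes n).subtype (fun k => k ≠ 0) : Finset Z0) : Set Z0)ᶜ : Set Z0),
        ENNReal.ofReal ((n : ℝ) ^ (-(2 * (s - σ)))) *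
          ENNReal.ofReal (|(k.1.1 : ℝ)| ^ (2 * s) * ‖a k.1‖ ^ 2) := by
        refine ENNReal.tsum_le_tsum fun k => ?_
        rw [← ENNReal.ofReal_mul (by positivity)]
        apply ENNReal.ofReal_le_ofReal
        have hk : k.1.1 ∉ modes n := fun h => k.2 (by simpa using h)
        have hk' : (n : ℝ) ≤ |(k.1.1 : ℝ)| := by
          have h1 : ¬ |k.1.1| ≤ (n : ℤ) := fun h => hk (coe_mem_modes.2 h)
          rw [← Int.cast_abs]; exact_mod_cast (not_le.1 h1).le
        have hn0 : (0 : ℝ) < n := by exact_mod_cast hn1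
        have hk0 : (0 : ℝ) < |(k.1.1 : ℝ)| := hn0.trans_le hk'
        rw [← mul_assoc]
        gcongr
        calc |(k.1.1 : ℝ)| ^ (2 * σ) = |(k.1.1 : ℝ)| ^ (-(2 * (s - σ))) * |(k.1.1 : ℝ)| ^ (2 * s) := by
              rw [← Real.rpow_add hk0]; congr 1; ring
          _ ≤ _ := by
              gcongr ?_ * _
              exact Real.rpow_le_rpow_of_nonpos hn0 hk' (by linarith)
    _ = ENNReal.ofReal ((n : ℝ) ^ (-(2 * (s - σ)))) *
        ∑' k : ((((modes n).subtype (fun k => k ≠ 0) : Finset Z0) : Set Z0)ᶜ : Set Z0),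
          ENNReal.ofReal (|(k.1.1 : ℝ)| ^ (2 * s) * ‖a k.1‖ ^ 2) := ENNReal.tsum_mul_left
    _ ≤ ENNReal.ofReal ((n : ℝ) ^ (-(2 * (s - σ)))) * B := by
        gcongr
        exact (ENNReal.tsum_comp_le_tsum_of_injective Subtype.val_injective _).trans ha
    _ ≤ ε := hn

theorem hSum_sub_le (s : ℝ) (a b : Z0 → ℂ) :
    hSum s (fun k => a k - b k) ≤ 2 * hSum s a + 2 * hSum s b := by
  unfold hSum
  rw [← ENNReal.tsum_mul_left, ← ENNReal.tsum_mul_left, ← ENNReal.tsum_add]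
  refine ENNReal.tsum_le_tsum fun k => ?_
  rw [← ENNReal.ofReal_ofNat 2, ← ENNReal.ofReal_mul (by norm_num),
    ← ENNReal.ofReal_mul (by norm_num), ← ENNReal.ofReal_add (by positivity) (by positivity)]
  apply ENNReal.ofReal_le_ofReal
  have h1 : ‖a k - b k‖ ^ 2 ≤ 2 * ‖a k‖ ^ 2 + 2 * ‖b k‖ ^ 2 := by
    have := norm_sub_le (a k) (b k)
    have h0 := norm_nonneg (a k - b k)
    nlinarith [sq_nonneg (‖a k‖ - ‖b k‖)]
  calc _ ≤ |(k.1 : ℝ)| ^ (2 * s) * (2 * ‖a k‖ ^ 2 + 2 * ‖b k‖ ^ 2) := by gcongr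
    _ = _ := by ring

theorem hSum_le_of_tendsto {s : ℝ} {B : ℝ≥0∞} {a : ℕ → Z0 → ℂ} {b : Z0 → ℂ}
    (hab : ∀ k, Tendsto (fun n => a n k) atTop (𝓝 (b k))) (ha : ∀ n, hSum s (a n) ≤ B) :
    hSum s b ≤ B := by
  unfold hSum
  rw [ENNReal.tsum_eq_iSup_sum]
  refine iSup_le fun F => ?_
  have hlim := tendsto_finsetSum F fun k _ => ENNReal.tendsto_ofReal
    (((hab k).norm.pow 2).const_mul (|(k.1 : ℝ)| ^ (2 * s)))
  exact le_of_tendsto' hlim fun n => (ENNReal.sum_le_tsum F).trans (ha n)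

/-- The compact embedding of `Ḣ^s` in `Ḣ^σ`: a sequence bounded in `Ḣ^s` that converges
coefficientwise converges in `Ḣ^σ`. -/
theorem tendsto_hSum_sub {σ s : ℝ} (hσ : σ < s) {B : ℝ≥0∞} (hB : B ≠ ∞) {a : ℕ → Z0 → ℂ}
    {b : Z0 → ℂ} (hab : ∀ k, Tendsto (fun n => a n k) atTop (𝓝 (b k)))
    (ha : ∀ n, hSum s (a n) ≤ B) :
    Tendsto (fun n => hSum σ (fun k => a n k - b k)) atTop (𝓝 0) := by
  have h := tendsto_tsum_of_uniform_tail
    (x := fun n (k : Z0) => ENNReal.ofReal (|(k.1 : ℝ)| ^ (2 * σ) * ‖a n k - b k‖ ^ 2))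
    (y := fun _ => 0) (fun k => ?_) (fun ε hε => ?_)
  · simpa [hSum] using h
  · have h1 := ENNReal.tendsto_ofReal
      (((tendsto_sub_nhds_zero_iff.2 (hab k)).norm.pow 2).const_mul (|(k.1 : ℝ)| ^ (2 * σ)))
    simpa using h1
  · have hB' : 2 * B + 2 * B ≠ ∞ := by
      simp [ENNReal.add_eq_top, ENNReal.mul_eq_top, hB]
    obtain ⟨F, hF⟩ := exists_tail_le hσ hB' hε
    refine ⟨F, fun n => hF (fun k => a n k - b k) ((hSum_sub_le s _ _).trans ?_)⟩
    gcongr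
    · exact ha n
    · exact hSum_le_of_tendsto hab ha

theorem tendsto_hSum {σ s : ℝ} (hσ : σ < s) {B : ℝ≥0∞} (hB : B ≠ ∞) {a : ℕ → Z0 → ℂ}
    {b : Z0 → ℂ} (hab : ∀ k, Tendsto (fun n => a n k) atTop (𝓝 (b k)))
    (ha : ∀ n, hSum s (a n) ≤ B) :
    Tendsto (fun n => hSum σ (a n)) atTop (𝓝 (hSum σ b)) := by
  refine tendsto_tsum_of_uniform_tail (fun k => ?_) (fun ε hε => ?_)
  · exact ENNReal.tendsto_ofReal (((hab k).norm.pow 2).const_mul _)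
  · obtain ⟨F, hF⟩ := exists_tail_le hσ hB hε
    exact ⟨F, fun n => hF (a n) (ha n)⟩

theorem tendsto_hNorm_zero {σ : ℝ} {a : ℕ → Z0 → ℂ}
    (h : Tendsto (fun n => hSum σ (a n)) atTop (𝓝 0)) :
    Tendsto (fun n => hNorm σ (a n)) atTop (𝓝 0) := by
  have := (ENNReal.continuous_rpow_const (y := (1 / 2 : ℝ))).tendsto 0 |>.comp h
  rwa [ENNReal.zero_rpow_of_pos (by norm_num)] at this

/-! ### Duality pairing and oscillating convolution -/

theorem tsum_mul_le_rpow {ι : Type*} (f g : ι → ℝ≥0∞) :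
    ∑' i, f i * g i ≤ (∑' i, f i ^ 2) ^ (1 / 2 : ℝ) * (∑' i, g i ^ 2) ^ (1 / 2 : ℝ) := by
  rw [ENNReal.tsum_eq_iSup_sum]
  refine iSup_le fun F => ?_
  refine (ENNReal.inner_le_Lp_mul_Lq F f g Real.HolderConjugate.two_two).trans ?_
  gcongr <;> simp only [ENNReal.rpow_ofNat] <;> exact ENNReal.sum_le_tsum F

theorem ofReal_weight_eq (s : ℝ) (k : Z0) (z : ℂ) :
    ENNReal.ofReal (|(k.1 : ℝ)| ^ (2 * s) * ‖z‖ ^ 2) =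
      (ENNReal.ofReal (|(k.1 : ℝ)| ^ s) * ‖z‖ₑ) ^ 2 := by
  rw [← ofReal_norm, ← ENNReal.ofReal_mul (by positivity), ← ENNReal.ofReal_pow (by positivity),
    mul_pow, ← Real.rpow_natCast (|(k.1 : ℝ)| ^ s) 2, ← Real.rpow_mul (abs_nonneg _)]
  congr 3; push_cast; ring

theorem enorm_mul_conj_eq (s : ℝ) (k : Z0) (z w : ℂ) :
    ‖z * conj w‖ₑ = (ENNReal.ofReal (|(k.1 : ℝ)| ^ s) * ‖z‖ₑ) *
      (ENNReal.ofReal (|(k.1 : ℝ)| ^ (-s)) * ‖w‖ₑ) := by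
  have h0 : (0 : ℝ) < |(k.1 : ℝ)| := by linarith [one_le_abs_coe k]
  have h1 : ENNReal.ofReal (|(k.1 : ℝ)| ^ s) * ENNReal.ofReal (|(k.1 : ℝ)| ^ (-s)) = 1 := by
    rw [← ENNReal.ofReal_mul (by positivity), ← Real.rpow_add h0]; simp
  rw [enorm_mul, RCLike.enorm_conj, mul_mul_mul_comm, h1, one_mul]

theorem tsum_enorm_pairing_le (s : ℝ) (a φ : Z0 → ℂ) :
    ∑' k, ‖a k * conj (φ k)‖ₑ ≤ hNorm s a * hNorm (-s) φ := by
  simp_rw [hNorm_eq, hSum, ofReal_weight_eq, fun k => enorm_mul_conj_eq s k (a k) (φ k)]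
  exact tsum_mul_le_rpow _ _

theorem summable_of_tsum_enorm_ne_top {ι : Type*} {f : ι → ℂ} (h : ∑' i, ‖f i‖ₑ ≠ ∞) :
    Summable f := by
  have := ENNReal.tsum_coe_ne_top_iff_summable.1 h
  exact Summable.of_nnnorm this

theorem enorm_tsum_le {ι : Type*} {f : ι → ℂ} (h : ∑' i, ‖f i‖ₑ ≠ ∞) :
    ‖∑' i, f i‖ₑ ≤ ∑' i, ‖f i‖ₑ := by
  have hs := ENNReal.tsum_coe_ne_top_iff_summable.1 h
  have h1 := nnnorm_tsum_le hs
  have h2 : ∑' i, ‖f i‖ₑ = ((∑' i, ‖f i‖₊ : ℝ≥0) : ℝ≥0∞) := (ENNReal.coe_tsum hs).symm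
  rw [h2]
  exact ENNReal.coe_le_coe.2 h1

theorem hNorm_ne_top_iff {s : ℝ} {a : Z0 → ℂ} : hNorm s a ≠ ∞ ↔ hSum s a ≠ ∞ := by
  rw [hNorm_eq]; simp

theorem tsum_enorm_pairing_ne_top {s : ℝ} {a φ : Z0 → ℂ} (ha : hNorm s a ≠ ∞)
    (hφ : hNorm (-s) φ ≠ ∞) : ∑' k, ‖a k * conj (φ k)‖ₑ ≠ ∞ :=
  ne_top_of_le_ne_top (ENNReal.mul_ne_top ha hφ) (tsum_enorm_pairing_le s a φ)

/-- Bounded sequences in `Ḣ^s` that converge coefficientwise converge weakly. -/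
theorem tendsto_pairing {s : ℝ} {B : ℝ≥0∞} (hB : B ≠ ∞) {a : ℕ → Z0 → ℂ} {b φ : Z0 → ℂ}
    (hab : ∀ k, Tendsto (fun n => a n k) atTop (𝓝 (b k))) (ha : ∀ n, hSum s (a n) ≤ B)
    (hφ : hNorm (-s) φ ≠ ∞) :
    Tendsto (fun n => pairing (a n) φ) atTop (𝓝 (pairing b φ)) := by
  have hb := hSum_le_of_tendsto hab ha
  have hd : ∀ n, hSum s (fun k => a n k - b k) ≤ 2 * B + 2 * B := fun n =>
    (hSum_sub_le s _ _).trans (by gcongr; exact ha n)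
  have hB' : 2 * B + 2 * B ≠ ∞ := by simp [ENNReal.add_eq_top, ENNReal.mul_eq_top, hB]
  have hsub : ∀ n, ‖pairing (a n) φ - pairing b φ‖ₑ ≤
      ∑' k, ‖(a n k - b k) * conj (φ k)‖ₑ := fun n => by
    have h1 := summable_of_tsum_enorm_ne_top (tsum_enorm_pairing_ne_top
      (hNorm_ne_top_iff.2 (ne_top_of_le_ne_top hB (ha n))) hφ)
    have h2 := summable_of_tsum_enorm_ne_top (tsum_enorm_pairing_ne_top
      (hNorm_ne_top_iff.2 (ne_top_of_le_ne_top hB hb)) hφ)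
    unfold pairing
    rw [← h1.tsum_sub h2]
    simp_rw [← sub_mul]
    exact enorm_tsum_le (tsum_enorm_pairing_ne_top (a := fun k => a n k - b k)
      (hNorm_ne_top_iff.2 (ne_top_of_le_ne_top hB' (hd n))) hφ)
  have hlim : Tendsto (fun n => ∑' k, ‖(a n k - b k) * conj (φ k)‖ₑ) atTop (𝓝 0) := by
    have h := tendsto_tsum_of_uniform_tail
      (x := fun n (k : Z0) => ‖(a n k - b k) * conj (φ k)‖ₑ) (y := fun _ => 0)
      (fun k => ?_) (fun ε hε => ?_)
    · simpa using h
    · have h1 := ((tendsto_sub_nhds_zero_iff.2 (hab k)).mul_const (conj (φ k))).enorm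
      simpa using h1
    · have ht := ENNReal.tendsto_tsum_compl_atTop_zero (hNorm_ne_top_iff.1 hφ)
      have ht2 : Tendsto (fun F : Finset Z0 => (2 * B + 2 * B) ^ (1 / 2 : ℝ) *
          (∑' k : {k : Z0 // k ∉ F},
            ENNReal.ofReal (|(k.1.1 : ℝ)| ^ (2 * (-s)) * ‖φ k.1‖ ^ 2)) ^ (1 / 2 : ℝ)) atTop
          (𝓝 ((2 * B + 2 * B) ^ (1 / 2 : ℝ) * 0)) := by
        refine ENNReal.Tendsto.const_mul ?_ (Or.inr (by simp [hB']))
        have := (ENNReal.continuous_rpow_const (y := (1 / 2 : ℝ))).tendsto 0 |>.comp ht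
        rwa [ENNReal.zero_rpow_of_pos (by norm_num)] at this
      rw [mul_zero] at ht2
      obtain ⟨F, hF⟩ := (ht2.eventually_le_const (ENNReal.coe_pos.2 hε)).exists
      refine ⟨F, fun n => le_trans ?_ hF⟩
      simp_rw [fun k : ((F : Set Z0)ᶜ : Set Z0) =>
        enorm_mul_conj_eq s k.1 (a n k.1 - b k.1) (φ k.1)]
      refine (tsum_mul_le_rpow _ _).trans ?_
      simp_rw [← ofReal_weight_eq]
      gcongr ?_ ^ _ * ?_ ^ _
      · exact (ENNReal.tsum_comp_le_tsum_of_injective Subtype.val_injective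
          fun k : Z0 => ENNReal.ofReal (|(k.1 : ℝ)| ^ (2 * s) * ‖a n k - b k‖ ^ 2)).trans (hd n)
      · exact le_rfl
  rw [tendsto_iff_edist_tendsto_0]
  simp_rw [edist_eq_enorm_sub]
  exact tendsto_of_tendsto_of_tendsto_of_le_of_le tendsto_const_nhds hlim (fun _ => zero_le) hsub

theorem hSum_zero_eq_tsum (a : Z0 → ℂ) : hSum 0 a = ∑' k, ‖a k‖ₑ ^ 2 := by
  unfold hSum
  refine tsum_congr fun k => ?_
  rw [ofReal_weight_eq]; simp

/-- The terms of the oscillating convolution are absolutely summable on `ℓ²`, by Cauchy–Schwarz. -/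
theorem tsum_enorm_oscConv_le (t : ℝ) (a b : Z0 → ℂ) (k : Z0) :
    ∑' p : {p : Z0 × Z0 // p.1.1 + p.2.1 = k.1},
      ‖Complex.exp (Complex.I * 3 * (k.1 : ℂ) * (p.1.1.1 : ℂ) * (p.1.2.1 : ℂ) * (t : ℂ)) *
        a p.1.1 * b p.1.2‖ₑ ≤ hNorm 0 a * hNorm 0 b := by
  have he : ∀ p : {p : Z0 × Z0 // p.1.1 + p.2.1 = k.1},
      ‖Complex.exp (Complex.I * 3 * (k.1 : ℂ) * (p.1.1.1 : ℂ) * (p.1.2.1 : ℂ) * (t : ℂ)) *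
        a p.1.1 * b p.1.2‖ₑ = ‖a p.1.1‖ₑ * ‖b p.1.2‖ₑ := fun p => by
    have e : Complex.I * 3 * (k.1 : ℂ) * (p.1.1.1 : ℂ) * (p.1.2.1 : ℂ) * (t : ℂ) =
      ((3 * k.1 * p.1.1.1 * p.1.2.1 * t : ℝ) : ℂ) * Complex.I := by push_cast; ring
    have h1 : ‖Complex.exp (Complex.I * 3 * (k.1 : ℂ) * (p.1.1.1 : ℂ) * (p.1.2.1 : ℂ) *
        (t : ℂ))‖ₑ = 1 := by
      rw [e, ← ofReal_norm, Complex.norm_exp_ofReal_mul_I, ENNReal.ofReal_one]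
    rw [enorm_mul, enorm_mul, h1, one_mul]
  simp_rw [he, hNorm_eq, hSum_zero_eq_tsum]
  refine (tsum_mul_le_rpow _ _).trans ?_
  gcongr
  · refine ENNReal.tsum_comp_le_tsum_of_injective
      (f := fun p : {p : Z0 × Z0 // p.1.1 + p.2.1 = k.1} => p.1.1) ?_ (fun j => ‖a j‖ₑ ^ 2)
    rintro ⟨⟨⟨a, _⟩, ⟨b, _⟩⟩, h1⟩ ⟨⟨⟨c, _⟩, ⟨d, _⟩⟩, h2⟩ h
    simp at h h1 h2 ⊢
    omega
  · refine ENNReal.tsum_comp_le_tsum_of_injective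
      (f := fun p : {p : Z0 × Z0 // p.1.1 + p.2.1 = k.1} => p.1.2) ?_ (fun j => ‖b j‖ₑ ^ 2)
    rintro ⟨⟨⟨a, _⟩, ⟨b, _⟩⟩, h1⟩ ⟨⟨⟨c, _⟩, ⟨d, _⟩⟩, h2⟩ h
    simp at h h1 h2 ⊢
    omega

theorem enorm_oscConv_le {a b : Z0 → ℂ} (ha : hNorm 0 a ≠ ∞) (hb : hNorm 0 b ≠ ∞) (t : ℝ)
    (k : Z0) : ‖oscConv t a b k‖ₑ ≤ hNorm 0 a * hNorm 0 b :=
  (enorm_tsum_le (ne_top_of_le_ne_top (ENNReal.mul_ne_top ha hb)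
    (tsum_enorm_oscConv_le t a b k))).trans (tsum_enorm_oscConv_le t a b k)

theorem summable_oscConv {a b : Z0 → ℂ} (ha : hNorm 0 a ≠ ∞) (hb : hNorm 0 b ≠ ∞) (t : ℝ)
    (k : Z0) : Summable fun p : {p : Z0 × Z0 // p.1.1 + p.2.1 = k.1} =>
      Complex.exp (Complex.I * 3 * (k.1 : ℂ) * (p.1.1.1 : ℂ) * (p.1.2.1 : ℂ) * (t : ℂ)) *
        a p.1.1 * b p.1.2 :=
  summable_of_tsum_enorm_ne_top (ne_top_of_le_ne_top (ENNReal.mul_ne_top ha hb)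
    (tsum_enorm_oscConv_le t a b k))

/-- Continuity of the oscillating convolution on `ℓ²`. -/
theorem tendsto_oscConv {B : ℝ≥0} {a : ℕ → Z0 → ℂ} {b : Z0 → ℂ}
    (ha : ∀ n, hNorm 0 (a n) ≤ B) (hb : hNorm 0 b ≤ B)
    (h : Tendsto (fun n => hNorm 0 (fun k => a n k - b k)) atTop (𝓝 0)) (t : ℝ) (k : Z0) :
    Tendsto (fun n => oscConv t (a n) (a n) k) atTop (𝓝 (oscConv t b b k)) := by
  have hbt : hNorm 0 b ≠ ∞ := ne_top_of_le_ne_top ENNReal.coe_ne_top hb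
  have hat : ∀ n, hNorm 0 (a n) ≠ ∞ := fun n => ne_top_of_le_ne_top ENNReal.coe_ne_top (ha n)
  have hdt : ∀ n, hNorm 0 (fun k => a n k - b k) ≠ ∞ := fun n => by
    refine hNorm_ne_top_iff.2 (ne_top_of_le_ne_top ?_ (hSum_sub_le 0 (a n) b))
    simp [ENNReal.add_eq_top, ENNReal.mul_eq_top, hNorm_ne_top_iff.1 hbt,
      hNorm_ne_top_iff.1 (hat n)]
  have hsub : ∀ n, oscConv t (a n) (a n) k - oscConv t b b k =
      oscConv t (fun k => a n k - b k) (a n) k + oscConv t b (fun k => a n k - b k) k := fun n => by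
    unfold oscConv
    rw [← (summable_oscConv (hat n) (hat n) t k).tsum_sub (summable_oscConv hbt hbt t k),
      ← (summable_oscConv (hdt n) (hat n) t k).tsum_add (summable_oscConv hbt (hdt n) t k)]
    exact tsum_congr fun p => by ring
  have hle : ∀ n, ‖oscConv t (a n) (a n) k - oscConv t b b k‖ₑ ≤
      hNorm 0 (fun k => a n k - b k) * B + B * hNorm 0 (fun k => a n k - b k) := fun n => by
    rw [hsub]
    refine (enorm_add_le _ _).trans (add_le_add ?_ ?_)
    · exact (enorm_oscConv_le (hdt n) (hat n) t k).trans (by gcongr; exact ha n)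
    · exact (enorm_oscConv_le hbt (hdt n) t k).trans (by gcongr)
  have hlim : Tendsto (fun n => hNorm 0 (fun k => a n k - b k) * B +
      B * hNorm 0 (fun k => a n k - b k)) atTop (𝓝 (0 * B + B * 0)) :=
    (ENNReal.Tendsto.mul_const h (Or.inr ENNReal.coe_ne_top)).add
      (ENNReal.Tendsto.const_mul h (Or.inr ENNReal.coe_ne_top))
  rw [zero_mul, mul_zero, add_zero] at hlim
  rw [tendsto_iff_edist_tendsto_0]
  simp_rw [edist_eq_enorm_sub]
  exact tendsto_of_tendsto_of_tendsto_of_le_of_le tendsto_const_nhds hlim (fun _ => zero_le) hle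

/-! ### Convergence in time-dependent spaces -/

theorem aemeasurable_hNorm {μ : Measure ℝ} (s : ℝ) {v : ℝ → Z0 → ℂ}
    (hv : ∀ k, AEStronglyMeasurable (fun t => v t k) μ) :
    AEMeasurable (fun t => hNorm s (v t)) μ := by
  unfold hNorm
  refine AEMeasurable.pow_const (AEMeasurable.tsum fun k => ?_) _
  exact (((hv k).norm.aemeasurable.pow_const 2).const_mul _).ennreal_ofReal

theorem bochnerNorm_eq_lintegral {p : ℝ≥0∞} (hp0 : p ≠ 0) (hp : p ≠ ∞) (s T : ℝ)
    (v : ℝ → Z0 → ℂ) : bochnerNorm p s T v =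
      (∫⁻ t, hNorm s (v t) ^ p.toReal ∂(timeMeasure T)) ^ (1 / p.toReal) := by
  simp [bochnerNorm, eLpNorm_eq_lintegral_rpow_enorm_toReal hp0 hp]

theorem ae_timeMeasure_of_forall {T : ℝ} {P : ℝ → Prop} (h : ∀ t ∈ Set.Icc 0 T, P t) :
    ∀ᵐ t ∂(timeMeasure T), P t :=
  (ae_restrict_iff' measurableSet_Icc).2 (ae_of_all _ h)

theorem bochnerNorm_top_le {s T : ℝ} {v : ℝ → Z0 → ℂ} {M : ℝ≥0∞}
    (h : ∀ t ∈ Set.Icc 0 T, hNorm s (v t) ≤ M) : bochnerNorm ∞ s T v ≤ M := by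
  rw [bochnerNorm, eLpNorm_exponent_top, eLpNormEssSup]
  exact essSup_le_of_ae_le M (ae_timeMeasure_of_forall fun t ht => by simpa using h t ht)

instance isFiniteMeasure_timeMeasure (T : ℝ) : IsFiniteMeasure (timeMeasure T) := by
  unfold timeMeasure; infer_instance

theorem memBochner_of_bound {p : ℝ≥0∞} (hp0 : p ≠ 0) {s T : ℝ} {v : ℝ → Z0 → ℂ} {M : ℝ≥0∞}
    (hM : M ≠ ∞) (hv : ∀ k, AEStronglyMeasurable (fun t => v t k) (timeMeasure T))
    (h : ∀ t ∈ Set.Icc 0 T, hNorm s (v t) ≤ M) : MemBochner p s T v := by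
  refine ⟨hv, ?_⟩
  by_cases hp : p = ∞
  · rw [hp]
    exact (bochnerNorm_top_le h).trans_lt hM.lt_top
  · rw [bochnerNorm_eq_lintegral hp0 hp]
    refine ENNReal.rpow_lt_top_of_nonneg (by positivity) (ne_of_lt ?_)
    calc _ ≤ ∫⁻ _, M ^ p.toReal ∂(timeMeasure T) :=
          lintegral_mono_ae (ae_timeMeasure_of_forall fun t ht => by gcongr; exact h t ht)
      _ < ∞ := by
          rw [lintegral_const]
          exact ENNReal.mul_lt_top (ENNReal.rpow_lt_top_of_nonneg (by positivity) hM)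
            (measure_lt_top _ _)

theorem tendsto_bochnerNorm_zero {p : ℝ≥0∞} (hp0 : p ≠ 0) (hp : p ≠ ∞) {s T : ℝ}
    {v : ℕ → ℝ → Z0 → ℂ} {M : ℝ≥0∞} (hM : M ≠ ∞)
    (hv : ∀ n k, AEStronglyMeasurable (fun t => v n t k) (timeMeasure T))
    (hb : ∀ n, ∀ t ∈ Set.Icc 0 T, hNorm s (v n t) ≤ M)
    (h : ∀ t ∈ Set.Icc 0 T, Tendsto (fun n => hNorm s (v n t)) atTop (𝓝 0)) :
    Tendsto (fun n => bochnerNorm p s T (v n)) atTop (𝓝 0) := by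
  have hp' : 0 < p.toReal := ENNReal.toReal_pos hp0 hp
  simp_rw [bochnerNorm_eq_lintegral hp0 hp]
  have h1 : Tendsto (fun n => ∫⁻ t, hNorm s (v n t) ^ p.toReal ∂(timeMeasure T)) atTop
      (𝓝 (∫⁻ _, 0 ∂(timeMeasure T))) := by
    refine tendsto_lintegral_of_dominated_convergence' (fun _ => M ^ p.toReal)
      (fun n => (aemeasurable_hNorm s (hv n)).pow_const _)
      (fun n => ae_timeMeasure_of_forall fun t ht =>
        ENNReal.rpow_le_rpow (hb n t ht) hp'.le) ?_
      (ae_timeMeasure_of_forall fun t ht => ?_)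
    · rw [lintegral_const]
      exact ENNReal.mul_ne_top (ENNReal.rpow_ne_top_of_nonneg hp'.le hM) (measure_ne_top _ _)
    · have := (ENNReal.continuous_rpow_const (y := p.toReal)).tendsto 0 |>.comp (h t ht)
      rwa [ENNReal.zero_rpow_of_pos hp'] at this
  rw [lintegral_zero] at h1
  have := (ENNReal.continuous_rpow_const (y := 1 / p.toReal)).tendsto 0 |>.comp h1
  rwa [ENNReal.zero_rpow_of_pos (by positivity)] at this

theorem aestronglyMeasurable_pairing {μ : Measure ℝ} {s : ℝ} {v φ : ℝ → Z0 → ℂ}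
    (hv : ∀ k, AEStronglyMeasurable (fun t => v t k) μ)
    (hφ : ∀ k, AEStronglyMeasurable (fun t => φ t k) μ)
    (hvt : ∀ᵐ t ∂μ, hNorm s (v t) ≠ ∞) (hφt : ∀ᵐ t ∂μ, hNorm (-s) (φ t) ≠ ∞) :
    AEStronglyMeasurable (fun t => pairing (v t) (φ t)) μ := by
  refine aestronglyMeasurable_of_tendsto_ae (atTop : Filter (Finset Z0))
    (f := fun F t => ∑ k ∈ F, v t k * conj (φ t k)) (fun F => ?_) ?_
  · exact Finset.aestronglyMeasurable_fun_sum F fun k _ =>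
      (hv k).mul (Complex.continuous_conj.comp_aestronglyMeasurable (hφ k))
  · filter_upwards [hvt, hφt] with t h1 h2
    exact (summable_of_tsum_enorm_ne_top (tsum_enorm_pairing_ne_top h1 h2)).hasSum

/-- Weak-* convergence in `L_∞([0,T]; Ḣ^s)` from a uniform bound and coefficientwise convergence at
every time. -/
theorem weakStarConv_of_tendsto {s T : ℝ} {u : ℕ → ℝ → Z0 → ℂ} {v : ℝ → Z0 → ℂ} {M : ℝ≥0}
    (hu : ∀ n k, AEStronglyMeasurable (fun t => u n t k) (timeMeasure T))
    (hv : ∀ k, AEStronglyMeasurable (fun t => v t k) (timeMeasure T))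
    (hb : ∀ n, ∀ t ∈ Set.Icc 0 T, hNorm s (u n t) ≤ M)
    (hbv : ∀ t ∈ Set.Icc 0 T, hNorm s (v t) ≤ M)
    (h : ∀ t ∈ Set.Icc 0 T, ∀ k, Tendsto (fun n => u n t k) atTop (𝓝 (v t k))) :
    WeakStarConv s T u v := by
  refine ⟨fun n => memBochner_of_bound ENNReal.top_ne_zero ENNReal.coe_ne_top (hu n) (hb n),
    memBochner_of_bound ENNReal.top_ne_zero ENNReal.coe_ne_top hv hbv, fun φ hφ => ?_⟩
  have hφm := aemeasurable_hNorm (-s) hφ.1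
  have hφi : ∫⁻ t, hNorm (-s) (φ t) ∂(timeMeasure T) ≠ ∞ := by
    have := hφ.2
    rw [bochnerNorm_eq_lintegral one_ne_zero ENNReal.one_ne_top] at this
    simpa using this.ne
  have hφt : ∀ᵐ t ∂(timeMeasure T), hNorm (-s) (φ t) ≠ ∞ := by
    filter_upwards [ae_lt_top' hφm hφi] with t ht using ht.ne
  refine tendsto_integral_of_dominated_convergence
    (fun t => (M : ℝ) * (hNorm (-s) (φ t)).toReal) (fun n => ?_) ?_ (fun n => ?_) ?_
  · exact aestronglyMeasurable_pairing (s := s) (hu n) hφ.1 (ae_timeMeasure_of_forall fun t ht =>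
      ne_top_of_le_ne_top ENNReal.coe_ne_top (hb n t ht)) hφt
  · exact (integrable_toReal_of_lintegral_ne_top hφm hφi).const_mul _
  · filter_upwards [hφt, ae_timeMeasure_of_forall (hb n)] with t h1 h2
    have h3 : hNorm s (u n t) ≠ ∞ := ne_top_of_le_ne_top ENNReal.coe_ne_top h2
    have h4 : ‖pairing (u n t) (φ t)‖ₑ ≤ M * hNorm (-s) (φ t) :=
      (enorm_tsum_le (tsum_enorm_pairing_ne_top h3 h1)).trans
        ((tsum_enorm_pairing_le s _ _).trans (by gcongr))
    have h5 := ENNReal.toReal_mono (ENNReal.mul_ne_top ENNReal.coe_ne_top h1) h4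
    rwa [toReal_enorm, ENNReal.toReal_mul, ENNReal.coe_toReal] at h5
  · filter_upwards [hφt, ae_timeMeasure_of_forall (P := fun t => t ∈ Set.Icc 0 T)
      fun t ht => ht] with t h1 ht
    exact tendsto_pairing (B := (M : ℝ≥0∞) ^ 2) (ENNReal.pow_ne_top ENNReal.coe_ne_top) (h t ht)
      (fun n => hNorm_le_iff.1 (hb n t ht)) h1

/-! ### Extraction of a subsequence and passage to the limit -/

/-- A diagonal Arzelà–Ascoli argument: bounded, equi-Lipschitz coefficients have a common
subsequence converging at every time. The subsequence is extracted at rational times. -/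
theorem exists_subseq_tendsto {T B : ℝ} (hT : 0 ≤ T) {L : Z0 → ℝ} {v : ℕ → ℝ → Z0 → ℂ}
    (hB : ∀ n, ∀ t ∈ Set.Icc 0 T, ∀ k, ‖v n t k‖ ≤ B)
    (hL : ∀ n k, ∀ t ∈ Set.Icc 0 T, ∀ t' ∈ Set.Icc 0 T, ‖v n t k - v n t' k‖ ≤ L k * |t - t'|) :
    ∃ (ns : ℕ → ℕ) (w : ℝ → Z0 → ℂ), StrictMono ns ∧
      ∀ t ∈ Set.Icc 0 T, ∀ k, Tendsto (fun j => v (ns j) t k) atTop (𝓝 (w t k)) := by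
  set τ : ℝ → ℝ := fun q => max 0 (min q T) with hτ
  have hτmem : ∀ q, τ q ∈ Set.Icc 0 T := fun q =>
    ⟨le_max_left _ _, max_le hT (min_le_right _ _)⟩
  have hτc : Continuous τ := by fun_prop
  have hτeq : ∀ t ∈ Set.Icc 0 T, τ t = t := fun t ht => by
    simp [hτ, min_eq_left ht.2, max_eq_right ht.1]
  have hcpt : IsCompact (Set.pi Set.univ fun _ : Z0 × ℚ => Metric.closedBall (0 : ℂ) B) :=
    isCompact_univ_pi fun _ => isCompact_closedBall 0 B
  obtain ⟨a, -, ns, hns, hlim⟩ := hcpt.tendsto_subseq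
    (x := fun n (i : Z0 × ℚ) => v n (τ i.2) i.1)
    (fun n i _ => by simpa using hB n _ (hτmem _) i.1)
  have hq : ∀ (k : Z0) (q : ℚ), CauchySeq fun j => v (ns j) (τ q) k := fun k q =>
    ((tendsto_pi_nhds.1 hlim) (k, q)).cauchySeq
  have hc : ∀ t ∈ Set.Icc 0 T, ∀ k, ∃ z, Tendsto (fun j => v (ns j) t k) atTop (𝓝 z) := by
    intro t ht k
    refine cauchySeq_tendsto_of_complete (Metric.cauchySeq_iff.2 fun ε hε => ?_)
    have hopen : IsOpen {q : ℝ | L k * |t - τ q| < ε / 3} :=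
      isOpen_lt (by fun_prop) continuous_const
    obtain ⟨q, hqε⟩ := Rat.denseRange_cast.exists_mem_open hopen
      ⟨t, by simp only [Set.mem_ofPred_eq, hτeq t ht, sub_self, abs_zero, mul_zero]; positivity⟩
    obtain ⟨n₀, hn₀⟩ := Metric.cauchySeq_iff.1 (hq k q) (ε / 3) (by positivity)
    refine ⟨n₀, fun i hi j hj => ?_⟩
    have h1 := (hL (ns i) k t ht (τ q) (hτmem q)).trans_lt hqε
    have h2 := (hL (ns j) k t ht (τ q) (hτmem q)).trans_lt hqε
    have h3 := hn₀ i hi j hj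
    rw [← dist_eq_norm] at h1 h2
    calc dist (v (ns i) t k) (v (ns j) t k) ≤ dist (v (ns i) t k) (v (ns i) (τ q) k) +
          dist (v (ns i) (τ q) k) (v (ns j) (τ q) k) + dist (v (ns j) (τ q) k) (v (ns j) t k) :=
          dist_triangle4 _ _ _ _
      _ < ε := by rw [dist_comm (v (ns j) (τ q) k)]; linarith
  choose! w hw using hc
  exact ⟨ns, w, hns, hw⟩

theorem hSum_mono {σ s : ℝ} (h : σ ≤ s) (a : Z0 → ℂ) : hSum σ a ≤ hSum s a := by
  refine ENNReal.tsum_le_tsum fun k => ENNReal.ofReal_le_ofReal ?_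
  gcongr
  exact one_le_abs_coe k

theorem hNorm_mono {σ s : ℝ} (h : σ ≤ s) (a : Z0 → ℂ) : hNorm σ a ≤ hNorm s a := by
  rw [hNorm_le_iff, hNorm_sq]; exact hSum_mono h a

theorem hSum_trunc_le (s : ℝ) (m : ℕ) (a : Z0 → ℂ) : hSum s (trunc m a) ≤ hSum s a := by
  refine ENNReal.tsum_le_tsum fun k => ENNReal.ofReal_le_ofReal ?_
  gcongr
  unfold trunc
  split_ifs <;> simp

theorem hNorm_sub_le_of_le {s : ℝ} {a b : Z0 → ℂ} {M : ℝ≥0} (ha : hNorm s a ≤ M)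
    (hb : hNorm s b ≤ M) : hNorm s (fun k => a k - b k) ≤ 2 * M := by
  rw [hNorm_le_iff] at *
  calc _ ≤ 2 * hSum s a + 2 * hSum s b := hSum_sub_le s a b
    _ ≤ 2 * (M : ℝ≥0∞) ^ 2 + 2 * (M : ℝ≥0∞) ^ 2 := by gcongr
    _ = _ := by ring

theorem eventually_mem_modes {ns : ℕ → ℕ} (hns : StrictMono ns) (k : Z0) :
    ∀ᶠ j in atTop, k.1 ∈ modes (ns j) := by
  filter_upwards [hns.tendsto_atTop.eventually_ge_atTop k.1.natAbs] with j hj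
  rw [coe_mem_modes, Int.abs_eq_natAbs]; omega

/-- Passage to the limit in the quadratic nonlinearity at a fixed time. -/
theorem tendsto_field {s : ℝ} (hs : 0 < s) {M : ℝ≥0} {ns : ℕ → ℕ} (hns : StrictMono ns)
    {a : ℕ → Z0 → ℂ} {b : Z0 → ℂ} (ha : ∀ j, hNorm s (a j) ≤ M)
    (hab : ∀ k, Tendsto (fun j => a j k) atTop (𝓝 (b k))) (t : ℝ) (k : Z0) :
    Tendsto (fun j => field (ns j) t (extendZero (a j)) k.1) atTop
      (𝓝 (1 / 2 * Complex.I * (k.1 : ℂ) * oscConv t b b k)) := by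
  have htr : ∀ j, hSum s (trunc (ns j) (a j)) ≤ (M : ℝ≥0∞) ^ 2 := fun j =>
    (hSum_trunc_le s _ _).trans (hNorm_le_iff.1 (ha j))
  have hlim : ∀ k, Tendsto (fun j => trunc (ns j) (a j) k) atTop (𝓝 (b k)) := fun k => by
    refine (hab k).congr' ?_
    filter_upwards [eventually_mem_modes hns k] with j hj
    rw [trunc, if_pos (coe_mem_modes.1 hj)]
  have hM : (M : ℝ≥0∞) ^ 2 ≠ ∞ := ENNReal.pow_ne_top ENNReal.coe_ne_top
  have h1 := tendsto_oscConv (B := M)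
    (fun j => (hNorm_mono hs.le _).trans (hNorm_le_iff.2 (htr j)))
    ((hNorm_mono hs.le _).trans (hNorm_le_iff.2 (hSum_le_of_tendsto hlim htr)))
    (tendsto_hNorm_zero (tendsto_hSum_sub hs hM hlim htr)) t k
  refine (h1.const_mul (1 / 2 * Complex.I * (k.1 : ℂ))).congr' ?_
  filter_upwards [eventually_mem_modes hns k] with j hj
  rw [← galerkin_rhs_eq t (a j) hj]
  congr 1
  conv_rhs => rw [trunc, if_pos (coe_mem_modes.1 hj)]

/-- A coefficientwise limit of Galerkin solutions that are bounded in `Ḣ^s` satisfies the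
time-integrated equation. -/
theorem limit_sub_eq_integral {s T : ℝ} (hs : 0 < s) {M B : ℝ≥0} {v0 : Z0 → ℂ}
    (hv0 : IsRealSeq v0) (hB : hNorm 0 v0 ≤ B) {ns : ℕ → ℕ} (hns : StrictMono ns)
    {v : ℕ → ℝ → Z0 → ℂ} (hv : ∀ j, IsGalerkinSolution (ns j) T v0 (v j)) {w : ℝ → Z0 → ℂ}
    (hM : ∀ j, ∀ t ∈ Set.Icc 0 T, hNorm s (v j t) ≤ M)
    (hw : ∀ t ∈ Set.Icc 0 T, ∀ k, Tendsto (fun j => v j t k) atTop (𝓝 (w t k)))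
    (k : Z0) {t : ℝ} (ht : t ∈ Set.Icc 0 T) :
    w t k - w 0 k =
      1 / 2 * Complex.I * (k.1 : ℂ) * ∫ τ in (0 : ℝ)..t, oscConv τ (w τ) (w τ) k := by
  have h0 : (0 : ℝ) ∈ Set.Icc 0 T := ⟨le_rfl, ht.1.trans ht.2⟩
  have hsub : Set.uIoc 0 t ⊆ Set.Icc 0 T := by
    rw [Set.uIoc_of_le ht.1]
    exact fun x hx => ⟨hx.1.le, hx.2.trans ht.2⟩
  have h1 : Tendsto (fun j => ∫ τ in (0 : ℝ)..t, field (ns j) τ (extendZero (v j τ)) k.1) atTop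
      (𝓝 (∫ τ in (0 : ℝ)..t, 1 / 2 * Complex.I * (k.1 : ℂ) * oscConv τ (w τ) (w τ) k)) := by
    refine intervalIntegral.tendsto_integral_filter_of_dominated_convergence
      (fun _ => 1 / 2 * |(k.1 : ℝ)| * (B : ℝ) ^ 2) ?_ ?_ ?_ ?_
    · exact Eventually.of_forall fun j =>
        (((hv j).continuousOn_field k.1).mono hsub).aestronglyMeasurable measurableSet_uIoc
    · exact Eventually.of_forall fun j => ae_of_all _ fun τ hτ =>
        (hv j).norm_field_le hv0 hB k.1 (hsub hτ)
    · exact intervalIntegrable_const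
    · exact ae_of_all _ fun τ hτ =>
        tendsto_field hs hns (fun j => hM j τ (hsub hτ)) (hw τ (hsub hτ)) τ k
  rw [intervalIntegral.integral_const_mul] at h1
  refine tendsto_nhds_unique ((hw t ht k).sub (hw 0 h0 k)) (h1.congr' ?_)
  filter_upwards [eventually_mem_modes hns k] with j hj
  exact ((hv j).sub_eq_integral hj ht).symm

end PeriodicKdV

open PeriodicKdV in
theorem theoremT (s₀ T : ℝ) (hs₀ : 0 < s₀) (hT : 0 < T) (M₀ N : ℝ≥0) :
    ∃ M : ℝ≥0, ∀ v0 : PeriodicKdV.Z0 → ℂ, PeriodicKdV.IsRealSeq v0 →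
      PeriodicKdV.hNorm 0 v0 ≤ (M₀ : ℝ≥0∞) → PeriodicKdV.hNorm s₀ v0 ≤ (N : ℝ≥0∞) →
      (∀ m : ℕ, ∃ v : ℝ → PeriodicKdV.Z0 → ℂ, PeriodicKdV.IsGalerkinSolution m T v0 v) ∧
      ∀ v : ℕ → ℝ → PeriodicKdV.Z0 → ℂ,
        (∀ m : ℕ, PeriodicKdV.IsGalerkinSolution m T v0 (v m)) →
        (∀ m : ℕ, ∀ t ∈ Set.Icc (0 : ℝ) T, PeriodicKdV.hNorm s₀ (v m t) ≤ (M : ℝ≥0∞)) ∧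
        ∀ σ : ℝ, 0 < σ → σ < s₀ →
          ∃ (ns : ℕ → ℕ) (vInf : ℝ → PeriodicKdV.Z0 → ℂ), StrictMono ns ∧
            (∀ p : ℝ≥0∞, 1 < p → p < ∞ →
              PeriodicKdV.StrongConv p σ T (fun j => v (ns j)) vInf) ∧
            PeriodicKdV.WeakStarConv s₀ T (fun j => v (ns j)) vInf ∧
            PeriodicKdV.IsSolution T vInf ∧
            vInf 0 = v0 ∧
            (∀ t ∈ Set.Icc (0 : ℝ) T, PeriodicKdV.IsRealSeq (vInf t)) ∧
            PeriodicKdV.bochnerNorm ∞ s₀ T vInf ≤ (M : ℝ≥0∞) ∧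
            ∀ᵐ t ∂(PeriodicKdV.timeMeasure T),
              PeriodicKdV.hNorm 0 (vInf t) = PeriodicKdV.hNorm 0 v0 := by
  obtain ⟨M, hM⟩ := exists_galerkin_hNorm_le hs₀ T M₀ N
  refine ⟨M, fun v0 hv0 h0 hN => ⟨fun m => exists_isGalerkinSolution m hT.le hv0,
    fun v hv => ⟨fun m t ht => hM v0 hv0 h0 hN m (v m) (hv m) t ht, fun σ _ hσ => ?_⟩⟩⟩
  have hb : ∀ m, ∀ t ∈ Set.Icc (0 : ℝ) T, hNorm s₀ (v m t) ≤ M := fun m =>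
    hM v0 hv0 h0 hN m (v m) (hv m)
  have hMtop : (M : ℝ≥0∞) ^ 2 ≠ ∞ := ENNReal.pow_ne_top ENNReal.coe_ne_top
  have hLip := fun n k t ht t' ht' => (hv n).norm_sub_le hv0 h0 k (t := t) (t' := t') ht ht'
  obtain ⟨ns, w, hns, hw⟩ := exists_subseq_tendsto (B := (M : ℝ)) hT.le
    (fun n t ht k => norm_le_of_hNorm_zero_le ((hNorm_mono hs₀.le _).trans (hb n t ht)) k) hLip
  have hbw : ∀ t ∈ Set.Icc (0 : ℝ) T, hNorm s₀ (w t) ≤ M := fun t ht =>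
    hNorm_le_iff.2 (hSum_le_of_tendsto (hw t ht) fun j => hNorm_le_iff.1 (hb (ns j) t ht))
  have hum : ∀ n k, AEStronglyMeasurable (fun t => v n t k) (timeMeasure T) := fun n k =>
    ((hv n).continuousOn k).aestronglyMeasurable measurableSet_Icc
  have hwm : ∀ k, AEStronglyMeasurable (fun t => w t k) (timeMeasure T) := fun k =>
    aestronglyMeasurable_of_tendsto_ae atTop (fun j => hum (ns j) k)
      (ae_timeMeasure_of_forall fun t ht => hw t ht k)
  have h0T : (0 : ℝ) ∈ Set.Icc 0 T := ⟨le_rfl, hT.le⟩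
  refine ⟨ns, w, hns, fun p hp1 hp => ?_, ?_, ?_, ?_, fun t ht k => ?_, bochnerNorm_top_le hbw, ?_⟩
  · have hp0 : p ≠ 0 := (zero_lt_one.trans hp1).ne'
    refine ⟨fun j => memBochner_of_bound hp0 ENNReal.coe_ne_top (hum (ns j))
      fun t ht => (hNorm_mono hσ.le _).trans (hb (ns j) t ht),
      memBochner_of_bound hp0 ENNReal.coe_ne_top hwm
        fun t ht => (hNorm_mono hσ.le _).trans (hbw t ht), ?_⟩
    refine tendsto_bochnerNorm_zero hp0 hp.ne (M := 2 * M)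
      (ENNReal.mul_ne_top ENNReal.ofNat_ne_top ENNReal.coe_ne_top)
      (fun j k => (hum (ns j) k).sub (hwm k))
      (fun j t ht => (hNorm_mono hσ.le _).trans (hNorm_sub_le_of_le (hb (ns j) t ht) (hbw t ht)))
      (fun t ht => tendsto_hNorm_zero (tendsto_hSum_sub hσ hMtop (hw t ht)
        fun j => hNorm_le_iff.1 (hb (ns j) t ht)))
  · exact weakStarConv_of_tendsto (fun j => hum (ns j)) hwm (fun j => hb (ns j)) hbw hw
  · exact ⟨memBochner_of_bound ENNReal.top_ne_zero ENNReal.coe_ne_top hwm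
      fun t ht => (hNorm_mono hs₀.le _).trans (hbw t ht),
      fun k t ht => limit_sub_eq_integral hs₀ hv0 h0 hns (fun j => hv (ns j))
        (fun j => hb (ns j)) hw k ht⟩
  · funext k
    refine tendsto_nhds_unique (hw 0 h0T k) ?_
    simp_rw [(hv _).1]
    exact tendsto_const_nhds
  · refine tendsto_nhds_unique (hw t ht (neg k)) ?_
    simp_rw [(hv _).isRealSeq hv0 ht k]
    exact (Complex.continuous_conj.tendsto _).comp (hw t ht k)
  · refine ae_timeMeasure_of_forall fun t ht => ?_
    have h1 := tendsto_hSum hs₀ hMtop (hw t ht) fun j => hNorm_le_iff.1 (hb (ns j) t ht)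
    simp_rw [(hv _).hSum_zero_eq hv0 ht] at h1
    rw [hNorm_eq, hNorm_eq, tendsto_nhds_unique h1 tendsto_const_nhds]
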